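/- Let $\Bbbk$ be an algebraically closed field of characteristic zero. \emph{Bosonizations.} Let $G$ be a finite abelian group, $\theta \in \mathbb N$, $g_1,\dots,g_\theta \in G$, and let $\chi_1,\dots,\chi_\theta : G \to \Bbbk^\times$ be characters such that $\chi_i(g_j) = \chi_j(g_i)^{-1}$ for $i \neq j$ and $m_i := \mathrm{ord}(\chi_i(g_i)) \geq 2$ for all $i$. Let $B(G,\underline g,\underline\chi)$ denote the Hopf algebra over $\Bbbk$ generated by $G$ and $x_1,\dots,x_\theta$, with the relations of $G$ and $$x_i^{m_i} = 0,\qquad x_i x_j = \chi_j(g_i)\, x_j x_i \ (i\neq j),\qquad h x_i = \chi_i(h)\, x_i h \ (h \in G),$$ and with comultiplication $\Delta(h) = h\otimes h$ for $h\in G$ and $\Delta(x_i) = g_i \otimes x_i + x_i \otimes 1$. The number $\theta$ is called its rank. A Hopf algebra $H$ acts on an algebra $A$ if $A$ is a left $H$-module algebra. \emph{Quantum matrices.} For $q \in \Bbbk^\times$ let $\mathcal O_q(M_2(\Bbbk))$ be the algebra generated by $Y_{11}=A$, $Y_{12}=B$, $Y_{21}=C$, $Y_{22}=D$ with relations $AB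 = qBA$, $AC=qCA$, $BD=qDB$, $CD=qDC$, $BC=CB$, $AD = DA+(q-q^{-1})BC$. Let $\mathcal H$ be the group of its automorphisms of the form $Y_{ij}\mapsto a_ib_jY_{ij}$ with $a_1,a_2,b_1,b_2\in \Bbbk^\times$, and let $\tau$ be the automorphism $Y_{ij}\mapsto Y_{ji}$. These generate the group $\mathcal H\rtimes\langle\tau\rangle$ of automorphisms. \textbf{Theorem.} (a) Let $q \in \Bbbk^\times$ with $q\neq\pm1$. Let $B(G,\underline g,\underline\chi)$ be a bosonization of rank $\theta$ as above with $m_i\neq 2$ for all $i$. Suppose that $B(G,\underline g,\underline\chi)$ acts on $\mathcal O_q(M_2(\Bbbk))$ such that each $g_i$ acts as an element of $\mathcal H\rtimes\langle\tau\rangle$, each $x_i$ maps $\mathrm{span}_\Bbbk\{A,B,C,D\}$ to itself, and each $x_i$ acts by a nonzero map. Then $\theta\leq 3$. (b) The bound is attained: for every primitive fifth root of unity $q\in\Bbbk$ there is a bosonization $B(G,\underline g,\underline\chi)$ of rank $3$ over $G = (\mathbb Z/5)^3$, with $m_i\neq2$ for all $i$, and an action of it on $\mathcal O_q(M_2(\Bbbk))$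 that satisfies all the assumptions of (a). -/

import Mathlib

open scoped TensorProduct

/-! ### Quantum linear spaces and their bosonizations -/

/-- The data `(g_1, …, g_θ; χ_1, …, χ_θ)` of a quantum linear space of rank `θ` over an abelian
group `G`: elements `g_i` of `G` and characters `χ_i : G → kˣ` with `χ_i(g_j) χ_j(g_i) = 1` for
`i ≠ j`, such that the order `m_i` of `χ_i(g_i)` is (finite and) at least `2`. -/
structure QuantumLinearDatum (k G : Type*) [Field k] [CommGroup G] (θ : ℕ) where
  g : Fin θ → G
  χ : Fin θ → G →* kˣ
  compat : ∀ i j, i ≠ j → χ i (g j) = (χ j (g i))⁻¹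
  two_le : ∀ i, 2 ≤ orderOf (χ i (g i))

namespace QuantumLinearDatum

variable {k G : Type*} [Field k] [CommGroup G] {θ : ℕ} (D : QuantumLinearDatum k G θ)

/-- `m_i`, the order of `χ_i(g_i)`. -/
noncomputable def m (i : Fin θ) : ℕ := orderOf (D.χ i (D.g i))

/-- The free generator attached to `h ∈ G`. -/
def freeGrp (_D : QuantumLinearDatum k G θ) (h : G) : FreeAlgebra k (G ⊕ Fin θ) :=
  FreeAlgebra.ι k (Sum.inl h)

/-- The free generator attached to `x_i`. -/
def freeX (_D : QuantumLinearDatum k G θ) (i : Fin θ) : FreeAlgebra k (G ⊕ Fin θ) :=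
  FreeAlgebra.ι k (Sum.inr i)

/-- The defining relations of the bosonization: the relations of `G`, and
`x_i ^ m_i = 0`, `x_i x_j = χ_j(g_i) x_j x_i` (`i ≠ j`), `h x_i = χ_i(h) x_i h`. -/
inductive Rel : FreeAlgebra k (G ⊕ Fin θ) → FreeAlgebra k (G ⊕ Fin θ) → Prop
  | grp_one : Rel (D.freeGrp 1) 1
  | grp_mul (h h' : G) : Rel (D.freeGrp h * D.freeGrp h') (D.freeGrp (h * h'))
  | x_pow (i : Fin θ) : Rel (D.freeX i ^ D.m i) 0
  | x_mul_x (i j : Fin θ) (hij : i ≠ j) :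
      Rel (D.freeX i * D.freeX j) ((D.χ j (D.g i) : k) • (D.freeX j * D.freeX i))
  | grp_mul_x (h : G) (i : Fin θ) :
      Rel (D.freeGrp h * D.freeX i) ((D.χ i h : k) • (D.freeX i * D.freeGrp h))

/-- The bosonization `B(G, g, χ)` of the quantum linear space, as an algebra. -/
def Bosonization : Type _ := RingQuot D.Rel

noncomputable instance : Ring D.Bosonization := inferInstanceAs (Ring (RingQuot D.Rel))

noncomputable instance : Algebra k D.Bosonization := inferInstanceAs (Algebra k (RingQuot D.Rel))

/-- The quotient map from the free algebra. -/
noncomputable def quot : FreeAlgebra k (G ⊕ Fin θ) →ₐ[k] D.Bosonization :=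
  RingQuot.mkAlgHom k D.Rel

/-- The element of the bosonization given by `h ∈ G`. -/
noncomputable def grp (h : G) : D.Bosonization := D.quot (D.freeGrp h)

/-- The generator `x_i` of the bosonization. -/
noncomputable def x (i : Fin θ) : D.Bosonization := D.quot (D.freeX i)

lemma quot_rel {a b : FreeAlgebra k (G ⊕ Fin θ)} (h : D.Rel a b) : D.quot a = D.quot b :=
  RingQuot.mkAlgHom_rel k h

lemma grp_one : D.grp 1 = 1 := by
  simpa [grp] using D.quot_rel Rel.grp_one

lemma grp_mul (h h' : G) : D.grp h * D.grp h' = D.grp (h * h') := by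
  simpa [grp] using D.quot_rel (Rel.grp_mul h h')

lemma x_pow (i : Fin θ) : D.x i ^ D.m i = 0 := by
  simpa [x] using D.quot_rel (Rel.x_pow i)

lemma x_mul_x {i j : Fin θ} (hij : i ≠ j) :
    D.x i * D.x j = (D.χ j (D.g i) : k) • (D.x j * D.x i) := by
  simpa [x] using D.quot_rel (Rel.x_mul_x i j hij)

lemma grp_mul_x (h : G) (i : Fin θ) :
    D.grp h * D.x i = (D.χ i h : k) • (D.x i * D.grp h) := by
  simpa [x, grp] using D.quot_rel (Rel.grp_mul_x h i)

section lift

variable {S : Type*} [Ring S] [Algebra k S] (f : G → S) (y : Fin θ → S)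

/-- The universal property of the bosonization, as an algebra given by generators and relations. -/
noncomputable def lift (f_one : f 1 = 1) (f_mul : ∀ h h', f h * f h' = f (h * h'))
    (y_pow : ∀ i, y i ^ D.m i = 0)
    (y_mul : ∀ i j, i ≠ j → y i * y j = (D.χ j (D.g i) : k) • (y j * y i))
    (f_mul_y : ∀ h i, f h * y i = (D.χ i h : k) • (y i * f h)) : D.Bosonization →ₐ[k] S :=
  RingQuot.liftAlgHom k ⟨FreeAlgebra.lift k (Sum.elim f y), by
    intro a b h
    cases h with
    | grp_one => simpa [freeGrp] using f_one
    | grp_mul h h' => simpa [freeGrp] using f_mul h h'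
    | x_pow i => simpa [freeX] using y_pow i
    | x_mul_x i j hij => simpa [freeX] using y_mul i j hij
    | grp_mul_x h i => simpa [freeX, freeGrp] using f_mul_y h i⟩

@[simp] lemma lift_grp (h1 h2 h3 h4 h5) (h : G) :
    D.lift f y h1 h2 h3 h4 h5 (D.grp h) = f h := by
  simp only [lift, grp, quot]
  erw [RingQuot.liftAlgHom_mkAlgHom_apply]
  simp [freeGrp]

@[simp] lemma lift_x (h1 h2 h3 h4 h5) (i : Fin θ) :
    D.lift f y h1 h2 h3 h4 h5 (D.x i) = y i := by
  simp only [lift, x, quot]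
  erw [RingQuot.liftAlgHom_mkAlgHom_apply]
  simp [freeX]

end lift

lemma algHom_ext {S : Type*} [Semiring S] [Algebra k S] {φ ψ : D.Bosonization →ₐ[k] S}
    (hg : ∀ h, φ (D.grp h) = ψ (D.grp h)) (hx : ∀ i, φ (D.x i) = ψ (D.x i)) : φ = ψ := by
  have h : φ.comp D.quot = ψ.comp D.quot := by
    apply FreeAlgebra.hom_ext
    funext s
    cases s with
    | inl h => exact hg h
    | inr i => exact hx i
  exact RingQuot.ringQuot_ext' k φ ψ h

lemma induction {P : D.Bosonization → Prop} (hg : ∀ h, P (D.grp h)) (hx : ∀ i, P (D.x i))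
    (hc : ∀ c : k, P (algebraMap k _ c)) (hadd : ∀ a b, P a → P b → P (a + b))
    (hmul : ∀ a b, P a → P b → P (a * b)) (a : D.Bosonization) : P a := by
  obtain ⟨a, rfl⟩ := RingQuot.mkAlgHom_surjective k D.Rel a
  change P (D.quot a)
  induction a using FreeAlgebra.induction with
  | grade0 r => simpa using hc r
  | grade1 s => cases s with
    | inl h => exact hg h
    | inr i => exact hx i
  | mul a b ha hb => simpa using hmul _ _ ha hb
  | add a b ha hb => simpa using hadd _ _ ha hb

/-! #### Powers of sums of `λ`-commuting elements -/

/-- Gaussian binomial coefficients. -/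
def gaussCoeff (l : k) : ℕ → ℕ → k
  | 0, 0 => 1
  | 0, _ + 1 => 0
  | n + 1, 0 => gaussCoeff l n 0
  | n + 1, i + 1 => l ^ (i + 1) * gaussCoeff l n (i + 1) + gaussCoeff l n i

lemma gaussCoeff_zero (l : k) (n : ℕ) : gaussCoeff l n 0 = 1 := by
  induction n with
  | zero => rfl
  | succ n ih => simpa [gaussCoeff] using ih

lemma gaussCoeff_eq_zero (l : k) {n i : ℕ} (h : n < i) : gaussCoeff l n i = 0 := by
  induction n generalizing i with
  | zero => cases i with
    | zero => omega
    | succ i => rfl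
  | succ n ih => cases i with
    | zero => omega
    | succ i => simp [gaussCoeff, ih (show n < i + 1 by omega), ih (show n < i by omega)]

lemma gaussCoeff_self (l : k) (n : ℕ) : gaussCoeff l n n = 1 := by
  induction n with
  | zero => rfl
  | succ n ih => simp [gaussCoeff, ih, gaussCoeff_eq_zero l (Nat.lt_succ_self n)]

lemma gaussCoeff_identities (l : k) (n : ℕ) : ∀ i,
    gaussCoeff l (n + 1) (i + 1) * (l ^ (i + 1) - 1) = gaussCoeff l n i * (l ^ (n + 1) - 1) ∧
    gaussCoeff l (n + 1) i * (l ^ (n + 1) - l ^ i) =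
      l ^ i * gaussCoeff l n i * (l ^ (n + 1) - 1) := by
  induction n with
  | zero =>
    intro i
    rcases i with _ | _ | i <;> simp [gaussCoeff]
  | succ n ih =>
    intro i
    refine ⟨?_, ?_⟩
    · have h1 := (ih i).1
      have h2 := (ih i).2
      rw [gaussCoeff]
      linear_combination l ^ (i + 1) * h1 - l * h2
    · rcases i with _ | i
      · simp [gaussCoeff_zero]
      · have h1 := (ih i).1
        have h2 := (ih i).2
        rw [gaussCoeff.eq_4 l (n + 1) i]
        linear_combination l * h2 - l ^ (i + 1) * h1

lemma gaussCoeff_order {l : k} {n i : ℕ} (hl : l ^ (n + 1) = 1)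
    (hi : l ^ (i + 1) ≠ 1) : gaussCoeff l (n + 1) (i + 1) = 0 := by
  have h := (gaussCoeff_identities l n i).1
  rw [hl, sub_self, mul_zero] at h
  exact (mul_eq_zero.mp h).resolve_right (sub_ne_zero.mpr hi)

section qcomm

variable {S : Type*} [Ring S] [Algebra k S]

lemma mul_pow_of_qcomm {l : k} {a b : S} (h : a * b = l • (b * a)) (n : ℕ) :
    a * b ^ n = l ^ n • (b ^ n * a) := by
  induction n with
  | zero => simp
  | succ n ih =>
    rw [pow_succ, ← mul_assoc, ih, smul_mul_assoc, mul_assoc, h, mul_smul_comm, smul_smul,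
      ← mul_assoc, ← pow_succ]

lemma add_pow_of_qcomm {l : k} {a b : S} (h : a * b = l • (b * a)) (n : ℕ) :
    (a + b) ^ n = ∑ p ∈ Finset.HasAntidiagonal.antidiagonal n, gaussCoeff l n p.1 • (b ^ p.1 * a ^ p.2) := by
  induction n with
  | zero => simp [gaussCoeff]
  | succ n ih =>
    have e : ∑ p ∈ Finset.HasAntidiagonal.antidiagonal (n + 1), gaussCoeff l (n + 1) p.1 • (b ^ p.1 * a ^ p.2) =
        ∑ p ∈ Finset.HasAntidiagonal.antidiagonal (n + 1), (l ^ p.1 * gaussCoeff l n p.1) • (b ^ p.1 * a ^ p.2) +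
        ∑ p ∈ Finset.HasAntidiagonal.antidiagonal n, gaussCoeff l n p.1 • (b ^ (p.1 + 1) * a ^ p.2) := by
      rw [Finset.Nat.sum_antidiagonal_succ, Finset.Nat.sum_antidiagonal_succ, add_assoc,
        ← Finset.sum_add_distrib]
      congr 1
      · simp [gaussCoeff_zero]
      · refine Finset.sum_congr rfl fun p _ => ?_
        rw [gaussCoeff, add_smul]
    rw [e, Finset.Nat.sum_antidiagonal_succ', pow_succ', ih, add_mul, Finset.mul_sum,
      Finset.mul_sum]
    simp only [gaussCoeff_eq_zero l (Nat.lt_succ_self n), mul_zero, zero_smul, zero_add]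
    congr 1
    · refine Finset.sum_congr rfl fun p _ => ?_
      rw [mul_smul_comm, ← mul_assoc, mul_pow_of_qcomm h, smul_mul_assoc, smul_smul, mul_assoc,
        ← pow_succ', mul_comm]
    · refine Finset.sum_congr rfl fun p _ => ?_
      rw [mul_smul_comm, ← mul_assoc, ← pow_succ']

lemma add_pow_orderOf {l : kˣ} {a b : S} (h : a * b = (l : k) • (b * a)) (hl : 2 ≤ orderOf l) :
    (a + b) ^ orderOf l = a ^ orderOf l + b ^ orderOf l := by
  obtain ⟨n, hn⟩ : ∃ n, orderOf l = n + 1 := ⟨orderOf l - 1, by omega⟩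
  have h1 : (l : k) ^ (n + 1) = 1 := by
    rw [← hn, ← Units.val_pow_eq_pow_val, pow_orderOf_eq_one, Units.val_one]
  rw [add_pow_of_qcomm h, hn, Finset.Nat.sum_antidiagonal_succ]
  simp only [gaussCoeff_zero, pow_zero, one_mul, one_smul]
  congr 1
  rw [Finset.sum_eq_single (n, 0)]
  · simp [gaussCoeff_self]
  · rintro ⟨i, j⟩ hij hne
    have hij' : i + j = n := by simpa using hij
    have hi : i < n := by
      rcases Nat.lt_or_ge i n with h | h
      · exact h
      · exact absurd (Prod.ext (by simp; omega) (by simp; omega)) hne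
    rw [gaussCoeff_order h1, zero_smul]
    intro hc
    rw [← Units.val_pow_eq_pow_val, Units.val_eq_one] at hc
    have := orderOf_le_of_pow_eq_one (Nat.succ_pos i) hc
    omega
  · intro h
    simp at h

lemma mul_pow_eq_zero_of_qcomm {l : k} {u y : S} (h : y * u = l • (u * y)) {n : ℕ}
    (hn : y ^ n = 0) : (u * y) ^ n = 0 := by
  have key : ∀ n, ∃ c : k, (u * y) ^ n = c • (u ^ n * y ^ n) := by
    intro n
    induction n with
    | zero => exact ⟨1, by simp⟩
    | succ n ih =>
      obtain ⟨c, hc⟩ := ih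
      have h' : y ^ n * u = l ^ n • (u * y ^ n) := by
        clear hc hn
        induction n with
        | zero => simp
        | succ n ih =>
          rw [pow_succ, mul_assoc, h, mul_smul_comm, ← mul_assoc, ih, smul_mul_assoc, smul_smul,
            mul_assoc, ← pow_succ, ← pow_succ']
      refine ⟨c * l ^ n, ?_⟩
      rw [pow_succ (u * y), hc, smul_mul_assoc, mul_assoc, ← mul_assoc (y ^ n), h',
        smul_mul_assoc, mul_smul_comm, smul_smul, mul_assoc, ← pow_succ, ← mul_assoc, ← pow_succ]
  obtain ⟨c, hc⟩ := key n
  rw [hc, hn, mul_zero, smul_zero]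

end qcomm

/-! #### The Hopf algebra structure -/

/-- The comultiplication: `Δ(h) = h ⊗ h` for `h ∈ G` and `Δ(x_i) = g_i ⊗ x_i + x_i ⊗ 1`. -/
noncomputable def comulHom : D.Bosonization →ₐ[k] D.Bosonization ⊗[k] D.Bosonization :=
  D.lift (fun h => D.grp h ⊗ₜ[k] D.grp h)
    (fun i => D.grp (D.g i) ⊗ₜ[k] D.x i + D.x i ⊗ₜ[k] 1)
    (by rw [D.grp_one]; rfl)
    (fun h h' => by rw [Algebra.TensorProduct.tmul_mul_tmul, D.grp_mul])
    (fun i => by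
      have h : (D.grp (D.g i) ⊗ₜ[k] D.x i) * (D.x i ⊗ₜ[k] (1 : D.Bosonization)) =
          (D.χ i (D.g i) : k) • ((D.x i ⊗ₜ[k] (1 : D.Bosonization)) *
            (D.grp (D.g i) ⊗ₜ[k] D.x i)) := by
        simp only [Algebra.TensorProduct.tmul_mul_tmul, mul_one, one_mul, D.grp_mul_x,
          TensorProduct.smul_tmul']
      rw [m, add_pow_orderOf h (D.two_le i), Algebra.TensorProduct.tmul_pow,
        Algebra.TensorProduct.tmul_pow, ← m, D.x_pow, TensorProduct.tmul_zero,
        TensorProduct.zero_tmul, add_zero])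
    (fun i j hij => by
      have h1 : (D.χ i (D.g j) : k) = (D.χ j (D.g i) : k)⁻¹ := by
        rw [D.compat i j hij, Units.val_inv_eq_inv_val]
      have h2 : (D.χ j (D.g i) : k) ≠ 0 := Units.ne_zero _
      simp only [mul_add, add_mul, Algebra.TensorProduct.tmul_mul_tmul, mul_one, one_mul,
        D.grp_mul_x, D.x_mul_x hij, D.grp_mul, TensorProduct.smul_tmul', smul_add, h1,
        TensorProduct.tmul_smul, smul_smul, mul_inv_cancel₀ h2, one_smul, mul_comm (D.g j)]
      abel)
    (fun h i => by
      simp only [mul_add, add_mul, Algebra.TensorProduct.tmul_mul_tmul, mul_one, one_mul,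
        D.grp_mul_x, D.grp_mul, TensorProduct.smul_tmul', smul_add,
        TensorProduct.tmul_smul, mul_comm h])

/-- The counit: `ε(h) = 1` for `h ∈ G` and `ε(x_i) = 0`. -/
noncomputable def counitHom : D.Bosonization →ₐ[k] k :=
  D.lift (fun _ => 1) (fun _ => 0) rfl (by simp)
    (fun i => zero_pow (by have := D.two_le i; unfold m; omega)) (by simp) (by simp)

@[simp] lemma comulHom_grp (h : G) : D.comulHom (D.grp h) = D.grp h ⊗ₜ[k] D.grp h :=
  D.lift_grp ..

@[simp] lemma comulHom_x (i : Fin θ) :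
    D.comulHom (D.x i) = D.grp (D.g i) ⊗ₜ[k] D.x i + D.x i ⊗ₜ[k] 1 :=
  D.lift_x ..

@[simp] lemma counitHom_grp (h : G) : D.counitHom (D.grp h) = 1 := D.lift_grp ..

@[simp] lemma counitHom_x (i : Fin θ) : D.counitHom (D.x i) = 0 := D.lift_x ..

noncomputable instance : Bialgebra k D.Bosonization :=
  Bialgebra.ofAlgHom D.comulHom D.counitHom
    (D.algHom_ext (fun h => by simp)
      (fun i => by
        simp [TensorProduct.tmul_add, TensorProduct.add_tmul, add_assoc,
          Algebra.TensorProduct.one_def]))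
    (D.algHom_ext (fun h => by simp) (fun i => by simp))
    (D.algHom_ext (fun h => by simp) (fun i => by simp))

lemma comul_eq (a : D.Bosonization) : Coalgebra.comul (R := k) a = D.comulHom a := rfl

lemma counit_eq (a : D.Bosonization) : Coalgebra.counit (R := k) a = D.counitHom a := rfl

/-- The antipode as an algebra homomorphism to the opposite algebra:
`S(h) = h⁻¹` for `h ∈ G` and `S(x_i) = -g_i⁻¹ x_i`. -/
noncomputable def antipodeHom : D.Bosonization →ₐ[k] D.Bosonizationᵐᵒᵖ :=
  D.lift (fun h => MulOpposite.op (D.grp h⁻¹))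
    (fun i => MulOpposite.op (-(D.grp (D.g i)⁻¹ * D.x i)))
    (by simp [D.grp_one])
    (fun h h' => by rw [← MulOpposite.op_mul, D.grp_mul, mul_inv_rev])
    (fun i => by
      rw [← MulOpposite.op_pow, neg_pow, mul_pow_eq_zero_of_qcomm (l := (D.χ i (D.g i) : k)),
        mul_zero, MulOpposite.op_zero]
      · rw [D.grp_mul_x, smul_smul, map_inv, Units.mul_inv, one_smul]
      · exact D.x_pow i)
    (fun i j hij => by
      have e : ∀ (h h' : G) (a b : Fin θ), (D.grp h * D.x a) * (D.grp h' * D.x b) =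
          (D.χ a h' : k)⁻¹ • (D.grp (h * h') * (D.x a * D.x b)) := by
        intro h h' a b
        have : D.x a * D.grp h' = (D.χ a h' : k)⁻¹ • (D.grp h' * D.x a) := by
          rw [D.grp_mul_x, smul_smul, inv_mul_cancel₀ (Units.ne_zero _), one_smul]
        rw [mul_assoc, ← mul_assoc (D.x a), this, smul_mul_assoc, mul_smul_comm, mul_assoc,
          ← mul_assoc, D.grp_mul]
      have h1 : (D.χ i (D.g j) : k) = (D.χ j (D.g i) : k)⁻¹ := by
        rw [D.compat i j hij, Units.val_inv_eq_inv_val]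
      have h2 : (D.χ j (D.g i) : k) ≠ 0 := Units.ne_zero _
      rw [← MulOpposite.op_mul, ← MulOpposite.op_mul, neg_mul_neg, neg_mul_neg, e, e,
        ← MulOpposite.op_smul, D.x_mul_x hij, mul_smul_comm, smul_smul, smul_smul,
        mul_comm (D.g j)⁻¹]
      congr 2
      simp only [map_inv, Units.val_inv_eq_inv_val, h1]
      field_simp)
    (fun h i => by
      have : D.x i * D.grp h⁻¹ = (D.χ i h : k) • (D.grp h⁻¹ * D.x i) := by
        rw [D.grp_mul_x, smul_smul, map_inv, Units.mul_inv, one_smul]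
      rw [← MulOpposite.op_mul, ← MulOpposite.op_mul, ← MulOpposite.op_smul, neg_mul, mul_neg,
        mul_assoc, this, mul_smul_comm, ← mul_assoc, ← mul_assoc, D.grp_mul, D.grp_mul,
        mul_comm h⁻¹, smul_neg])

/-- The antipode. -/
noncomputable def antipodeLin : D.Bosonization →ₗ[k] D.Bosonization :=
  (MulOpposite.opLinearEquiv k).symm.toLinearMap ∘ₗ D.antipodeHom.toLinearMap

lemma antipodeLin_apply (a : D.Bosonization) :
    D.antipodeLin a = (D.antipodeHom a).unop := rfl

lemma antipodeLin_mul (a b : D.Bosonization) :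
    D.antipodeLin (a * b) = D.antipodeLin b * D.antipodeLin a := by
  simp [antipodeLin_apply]

@[simp] lemma antipodeLin_algebraMap (c : k) :
    D.antipodeLin (algebraMap k _ c) = algebraMap k _ c := by
  simp [antipodeLin_apply]

@[simp] lemma antipodeLin_one : D.antipodeLin 1 = 1 := by
  simp [antipodeLin_apply]

@[simp] lemma antipodeLin_grp (h : G) : D.antipodeLin (D.grp h) = D.grp h⁻¹ := by
  rw [antipodeLin_apply, antipodeHom, lift_grp, MulOpposite.unop_op]

@[simp] lemma antipodeLin_x (i : Fin θ) :
    D.antipodeLin (D.x i) = -(D.grp (D.g i)⁻¹ * D.x i) := by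
  rw [antipodeLin_apply, antipodeHom, lift_x, MulOpposite.unop_op]

lemma antipode_left (a : D.Bosonization) :
    LinearMap.mul' k _ (D.antipodeLin.rTensor _ (D.comulHom a)) =
      algebraMap k _ (D.counitHom a) := by
  induction a using D.induction with
  | hg h => simp [D.grp_mul, D.grp_one]
  | hx i => simp
  | hc c => simp [Algebra.TensorProduct.algebraMap_apply]
  | hadd a b ha hb => simp [ha, hb]
  | hmul a b ha hb =>
    have h1 : ∀ (z : D.Bosonization ⊗[k] D.Bosonization) (s t : D.Bosonization),
        LinearMap.mul' k _ (D.antipodeLin.rTensor _ (z * s ⊗ₜ[k] t)) =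
          D.antipodeLin s * LinearMap.mul' k _ (D.antipodeLin.rTensor _ z) * t := by
      intro z s t
      induction z with
      | zero => simp
      | add z w hz hw => simp [add_mul, mul_add, hz, hw]
      | tmul u v => simp [antipodeLin_mul, mul_assoc]
    have h2 : ∀ w : D.Bosonization ⊗[k] D.Bosonization,
        LinearMap.mul' k _ (D.antipodeLin.rTensor _ (D.comulHom a * w)) =
          D.counitHom a • LinearMap.mul' k _ (D.antipodeLin.rTensor _ w) := by
      intro w
      induction w with
      | zero => simp
      | add z w hz hw => simp [mul_add, hz, hw]
      | tmul s t =>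
        rw [h1, ha, ← Algebra.commutes, ← Algebra.smul_def]
        simp
    rw [map_mul, h2, hb, map_mul, map_mul, Algebra.smul_def]

lemma antipode_right (a : D.Bosonization) :
    LinearMap.mul' k _ (D.antipodeLin.lTensor _ (D.comulHom a)) =
      algebraMap k _ (D.counitHom a) := by
  induction a using D.induction with
  | hg h => simp [D.grp_mul, D.grp_one]
  | hx i => simp [← mul_assoc, D.grp_mul, D.grp_one]
  | hc c => simp [Algebra.TensorProduct.algebraMap_apply]
  | hadd a b ha hb => simp [ha, hb]
  | hmul a b ha hb =>
    have h1 : ∀ (z : D.Bosonization ⊗[k] D.Bosonization) (s t : D.Bosonization),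
        LinearMap.mul' k _ (D.antipodeLin.lTensor _ (s ⊗ₜ[k] t * z)) =
          s * LinearMap.mul' k _ (D.antipodeLin.lTensor _ z) * D.antipodeLin t := by
      intro z s t
      induction z with
      | zero => simp
      | add z w hz hw => simp [add_mul, mul_add, hz, hw]
      | tmul u v => simp [antipodeLin_mul, mul_assoc]
    have h2 : ∀ w : D.Bosonization ⊗[k] D.Bosonization,
        LinearMap.mul' k _ (D.antipodeLin.lTensor _ (w * D.comulHom b)) =
          D.counitHom b • LinearMap.mul' k _ (D.antipodeLin.lTensor _ w) := by
      intro w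
      induction w with
      | zero => simp
      | add z w hz hw => simp [add_mul, hz, hw]
      | tmul s t =>
        rw [h1, hb, ← Algebra.commutes, mul_assoc, ← Algebra.smul_def]
        simp
    rw [map_mul, h2, ha, map_mul, mul_comm, map_mul, Algebra.smul_def]

noncomputable instance : HopfAlgebra k D.Bosonization where
  antipode := D.antipodeLin
  mul_antipode_rTensor_comul := LinearMap.ext D.antipode_left
  mul_antipode_lTensor_comul := LinearMap.ext D.antipode_right

end QuantumLinearDatum

/-! ### Hopf actions -/

/-- An action of a Hopf algebra `H` on an algebra `A`, i.e. the structure of a left `H`-module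
algebra: a left `H`-module structure `h ⊗ a ↦ h · a` on `A` (given as an algebra homomorphism
`H → End_k(A)`) with `h · 1 = ε(h) 1` and `h · (a b) = ∑ (h₁ · a) (h₂ · b)`. -/
structure HopfAction (k H A : Type*) [Field k] [Ring H] [HopfAlgebra k H] [Ring A]
    [Algebra k A] where
  act : H →ₐ[k] Module.End k A
  act_one : ∀ h : H, act h 1 = algebraMap k A (Coalgebra.counit h)
  act_mul : ∀ (h : H) (a b : A), act h (a * b) =
    LinearMap.mul' k A (TensorProduct.map (act.toLinearMap.flip a) (act.toLinearMap.flip b)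
      (Coalgebra.comul (R := k) h))

/-! ### Quantum matrix algebras -/

namespace QuantumMatrix

section

variable {k : Type*} [Field k] (q : k) (N : ℕ)

/-- The defining relations of the quantum matrix algebra `O_q(M_N(k))`. -/
inductive Rel : FreeAlgebra k (Fin N × Fin N) → FreeAlgebra k (Fin N × Fin N) → Prop
  | col (i l j : Fin N) (h : i < l) :
      Rel (FreeAlgebra.ι k (i, j) * FreeAlgebra.ι k (l, j))
        (q • (FreeAlgebra.ι k (l, j) * FreeAlgebra.ι k (i, j)))
  | row (i j m : Fin N) (h : j < m) :
      Rel (FreeAlgebra.ι k (i, j) * FreeAlgebra.ι k (i, m))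
        (q • (FreeAlgebra.ι k (i, m) * FreeAlgebra.ι k (i, j)))
  | anti (i j l m : Fin N) (h : i < l) (h' : m < j) :
      Rel (FreeAlgebra.ι k (i, j) * FreeAlgebra.ι k (l, m))
        (FreeAlgebra.ι k (l, m) * FreeAlgebra.ι k (i, j))
  | diag (i j l m : Fin N) (h : i < l) (h' : j < m) :
      Rel (FreeAlgebra.ι k (i, j) * FreeAlgebra.ι k (l, m))
        (FreeAlgebra.ι k (l, m) * FreeAlgebra.ι k (i, j) +
          (q - q⁻¹) • (FreeAlgebra.ι k (i, m) * FreeAlgebra.ι k (l, j)))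

end

end QuantumMatrix

/-- The single parameter quantum matrix algebra `O_q(M_N(k))`. -/
def QuantumMatrix {k : Type*} [Field k] (q : k) (N : ℕ) : Type _ :=
  RingQuot (QuantumMatrix.Rel q N)

namespace QuantumMatrix

variable {k : Type*} [Field k] (q : k) (N : ℕ)

noncomputable instance : Ring (QuantumMatrix q N) :=
  inferInstanceAs (Ring (RingQuot (Rel q N)))

noncomputable instance : Algebra k (QuantumMatrix q N) :=
  inferInstanceAs (Algebra k (RingQuot (Rel q N)))

/-- The quotient map from the free algebra. -/
noncomputable def quot : FreeAlgebra k (Fin N × Fin N) →ₐ[k] QuantumMatrix q N :=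
  RingQuot.mkAlgHom k (Rel q N)

/-- The generators `Y_{ij}`. -/
noncomputable def Y (i j : Fin N) : QuantumMatrix q N := quot q N (FreeAlgebra.ι k (i, j))

/-- The homogeneous component of degree one: the span of the generators `Y_{ij}`. -/
noncomputable def degreeOne : Submodule k (QuantumMatrix q N) :=
  Submodule.span k (Set.range fun p : Fin N × Fin N => Y q N p.1 p.2)

variable {N}

lemma rel_quot {a b : FreeAlgebra k (Fin N × Fin N)} (h : Rel q N a b) :
    quot q N a = quot q N b :=
  RingQuot.mkAlgHom_rel k h

lemma Y_col (i l j : Fin N) (h : i < l) :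
    Y q N i j * Y q N l j = q • (Y q N l j * Y q N i j) := by
  have := rel_quot q (Rel.col (q := q) i l j h)
  rw [map_mul, map_smul, map_mul] at this
  exact this

lemma Y_row (i j m : Fin N) (h : j < m) :
    Y q N i j * Y q N i m = q • (Y q N i m * Y q N i j) := by
  have := rel_quot q (Rel.row (q := q) i j m h)
  rw [map_mul, map_smul, map_mul] at this
  exact this

lemma Y_anti (i j l m : Fin N) (h : i < l) (h' : m < j) :
    Y q N i j * Y q N l m = Y q N l m * Y q N i j := by
  have := rel_quot q (Rel.anti (q := q) i j l m h h')
  rw [map_mul, map_mul] at this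
  exact this

lemma Y_diag (i j l m : Fin N) (h : i < l) (h' : j < m) :
    Y q N i j * Y q N l m =
      Y q N l m * Y q N i j + (q - q⁻¹) • (Y q N i m * Y q N l j) := by
  have := rel_quot q (Rel.diag (q := q) i j l m h h')
  rw [map_mul, map_add, map_smul, map_mul, map_mul] at this
  exact this

lemma algHom_ext {S : Type*} [Semiring S] [Algebra k S] {φ ψ : QuantumMatrix q N →ₐ[k] S}
    (h : ∀ i j, φ (Y q N i j) = ψ (Y q N i j)) : φ = ψ := by
  have h' : φ.comp (quot q N) = ψ.comp (quot q N) := by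
    apply FreeAlgebra.hom_ext
    funext s
    exact h s.1 s.2
  exact RingQuot.ringQuot_ext' k φ ψ h'

/-- The transposition `Y_{ij} ↦ Y_{ji}` as an algebra endomorphism. -/
noncomputable def transposeHom : QuantumMatrix q N →ₐ[k] QuantumMatrix q N :=
  RingQuot.liftAlgHom k ⟨FreeAlgebra.lift k fun p => Y q N p.2 p.1, by
    intro a b h
    cases h with
    | col i l j h => simpa using Y_row q j i l h
    | row i j m h => simpa using Y_col q j m i h
    | anti i j l m h h' => simpa using (Y_anti q m l j i h' h).symm
    | diag i j l m h h' =>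
      simpa [Y_anti q j l m i h' h] using Y_diag q j i m l h' h⟩

@[simp] lemma transposeHom_Y (i j : Fin N) : transposeHom q (Y q N i j) = Y q N j i := by
  unfold transposeHom
  conv_lhs => rw [Y, quot]
  erw [RingQuot.liftAlgHom_mkAlgHom_apply]
  simp

/-- The transposition automorphism `τ`, given by `Y_{ij} ↦ Y_{ji}`. -/
noncomputable def transpose : QuantumMatrix q N ≃ₐ[k] QuantumMatrix q N :=
  AlgEquiv.ofAlgHom (transposeHom q) (transposeHom q)
    (algHom_ext q fun i j => by simp) (algHom_ext q fun i j => by simp)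

variable (N)

/-- The group `𝓗` of the automorphisms of `O_q(M_N(k))` that multiply each generator `Y_{ij}` by
`a_i b_j`, for nonzero scalars `a_1, …, a_N, b_1, …, b_N`. Dividing all `b_j` and multiplying all
`a_i` by `b_N`, one may take `b_N = 1` here, so that `𝓗` is the torus `(kˣ)^{2N-1}`. -/
def torus : Subgroup (QuantumMatrix q N ≃ₐ[k] QuantumMatrix q N) where
  carrier := {φ | ∃ a b : Fin N → kˣ, ∀ i j, φ (Y q N i j) = ((a i : k) * b j) • Y q N i j}
  one_mem' := ⟨1, 1, fun i j => by simp⟩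
  mul_mem' := by
    rintro φ ψ ⟨a, b, h⟩ ⟨a', b', h'⟩
    refine ⟨a * a', b * b', fun i j => ?_⟩
    rw [AlgEquiv.mul_apply, h', map_smul, h, smul_smul]
    congr 1
    simp only [Pi.mul_apply, Units.val_mul]
    ring
  inv_mem' := by
    rintro φ ⟨a, b, h⟩
    refine ⟨a⁻¹, b⁻¹, fun i j => ?_⟩
    apply φ.injective
    rw [map_smul, h, smul_smul, ← AlgEquiv.mul_apply, mul_inv_cancel, AlgEquiv.one_apply]
    simp only [Pi.inv_apply, Units.val_inv_eq_inv_val]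
    have h1 : (a i : k) ≠ 0 := Units.ne_zero _
    have h2 : (b j : k) ≠ 0 := Units.ne_zero _
    have : (a i : k)⁻¹ * (b j : k)⁻¹ * (a i * b j) = 1 := by field_simp
    rw [this, one_smul]

/-- The group `𝓗 ⋊ ⟨τ⟩`, realized inside the automorphism group of `O_q(M_N(k))` as the subgroup
generated by `𝓗` and `τ`. -/
noncomputable def torusTranspose : Subgroup (QuantumMatrix q N ≃ₐ[k] QuantumMatrix q N) :=
  torus q N ⊔ Subgroup.zpowers (transpose q)

/-- The conditions imposed on an action of `B(G, g, χ)` on `O_q(M_N(k))`: each `g_i` acts as an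
element of `𝓗 ⋊ ⟨τ⟩`, and each `x_i` acts linearly (it maps the component of degree one to
itself) and by a nonzero map. -/
structure IsAdmissible {G : Type*} [CommGroup G] {θ : ℕ} (D : QuantumLinearDatum k G θ)
    (ρ : HopfAction k D.Bosonization (QuantumMatrix q N)) : Prop where
  grp_mem : ∀ i, ∃ φ ∈ torusTranspose q N, ∀ a, ρ.act (D.grp (D.g i)) a = φ a
  linear : ∀ i, ∀ a ∈ degreeOne q N, ρ.act (D.x i) a ∈ degreeOne q N
  ne_zero : ∀ i, ρ.act (D.x i) ≠ 0

end QuantumMatrix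

/-! Upper bound. Write `g_i` and `x_i` on the span of `A, B, C, D` as matrices `S` and `X`. A linear
functional on degree two is a Gram matrix `M` killing the quadratic relations, and pulling it back
along the skew derivation `x_i` gives the matrix `Sᵀ M X + Xᵀ M`, which must kill them again
(`IsForm.skewDerivation`). Testing ten such `M`, one for each ordered quadratic monomial, turns the
existence of `x_i` into finitely many equations in the entries of `S` and `X`. A further equation is
`S X = l X S` with `l = χ_i(g_i)`, where `l ^ 2 ≠ 1` because `m_i` is neither 1 nor 2.

If `g_i` involves the transposition, these equations force `X = 0` (`eq_zero_of_swapMatrix`). If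
`g_i` is diagonal, `X` has one of ten shapes, and in each of them the eigenvalues of `g_i` are
prescribed powers of `q` and `l` is `q ^ (±2)` or `q ^ (±4)` (`exists_isKind`). For two indices the
condition `χ_i(g_j) χ_j(g_i) = 1` becomes `q ^ w = 1` with an integer `w` depending only on the two
shapes; this is impossible for `w = ±2, ±4, ±8`. Three further pairs of shapes have `w = 0` but do
not commute up to a scalar (`IsKind.compatible`). What remains is a graph on ten vertices, without
loops, that has no four pairwise adjacent vertices (`not_four_compatible`).

Sharpness. The skew derivations `A ↦ D`; `A ↦ B, C ↦ D`; `A ↦ C, B ↦ D` are pairwise compatible.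
They come from homomorphisms into triangular 2 × 2 matrices (`exists_isSkewDerivation`). Each
relation of the bosonization says that some skew derivation is zero, so it need only be checked on
the four generators (`exists_hopfAction`). -/

namespace QuantumMatrix

/-! ### Generators of the quantum matrix algebra and its universal property for N = 2 -/

section generators

variable {k : Type*} [Field k] {q : k} {N : ℕ}

lemma induction {P : QuantumMatrix q N → Prop} (hY : ∀ i j, P (Y q N i j))
    (hc : ∀ c : k, P (algebraMap k _ c)) (hadd : ∀ a b, P a → P b → P (a + b))
    (hmul : ∀ a b, P a → P b → P (a * b)) (a : QuantumMatrix q N) : P a := by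
  obtain ⟨a, rfl⟩ := RingQuot.mkAlgHom_surjective k (Rel q N) a
  change P (quot q N a)
  induction a using FreeAlgebra.induction with
  | grade0 r => simpa using hc r
  | grade1 s => exact hY s.1 s.2
  | mul a b ha hb => simpa using hmul _ _ ha hb
  | add a b ha hb => simpa using hadd _ _ ha hb

/-- A `(σ, τ)`-derivation that vanishes on the generators is zero. -/
lemma eq_zero_of_skewDerivation (d : Module.End k (QuantumMatrix q N))
    (σ τ : QuantumMatrix q N → QuantumMatrix q N)
    (hd : ∀ a b, d (a * b) = σ a * d b + d a * τ b) (h1 : d 1 = 0)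
    (hY : ∀ i j, d (Y q N i j) = 0) : d = 0 := by
  ext a
  induction a using induction with
  | hY i j => exact hY i j
  | hc c => simp [Algebra.algebraMap_eq_smul_one, h1]
  | hadd a b ha hb => simpa using by rw [ha, hb]; simp
  | hmul a b ha hb => rw [hd, ha, hb]; simp

/-- The universal property of `O_q(M_2(k))`. -/
noncomputable def liftTwo {S : Type*} [Ring S] [Algebra k S] (y : Fin 2 → Fin 2 → S)
    (hAB : y 0 0 * y 0 1 = q • (y 0 1 * y 0 0)) (hAC : y 0 0 * y 1 0 = q • (y 1 0 * y 0 0))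
    (hBD : y 0 1 * y 1 1 = q • (y 1 1 * y 0 1)) (hCD : y 1 0 * y 1 1 = q • (y 1 1 * y 1 0))
    (hBC : y 0 1 * y 1 0 = y 1 0 * y 0 1)
    (hAD : y 0 0 * y 1 1 = y 1 1 * y 0 0 + (q - q⁻¹) • (y 0 1 * y 1 0)) :
    QuantumMatrix q 2 →ₐ[k] S :=
  RingQuot.liftAlgHom k ⟨FreeAlgebra.lift k fun p => y p.1 p.2, by
    intro a b h
    cases h with
    | col i l j h =>
      obtain ⟨rfl, rfl⟩ : i = 0 ∧ l = 1 := by omega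
      fin_cases j <;> simpa
    | row i j m h =>
      obtain ⟨rfl, rfl⟩ : j = 0 ∧ m = 1 := by omega
      fin_cases i <;> simpa
    | anti i j l m h h' =>
      obtain ⟨rfl, rfl, rfl, rfl⟩ : i = 0 ∧ l = 1 ∧ j = 1 ∧ m = 0 := by omega
      simpa
    | diag i j l m h h' =>
      obtain ⟨rfl, rfl, rfl, rfl⟩ : i = 0 ∧ l = 1 ∧ j = 0 ∧ m = 1 := by omega
      simpa⟩

@[simp] lemma liftTwo_Y {S : Type*} [Ring S] [Algebra k S] (y : Fin 2 → Fin 2 → S)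
    (h1 h2 h3 h4 h5 h6) (i j : Fin 2) :
    liftTwo (q := q) y h1 h2 h3 h4 h5 h6 (Y q 2 i j) = y i j := by
  unfold liftTwo
  conv_lhs => rw [Y, quot]
  erw [RingQuot.liftAlgHom_mkAlgHom_apply]
  simp

variable (q) in
/-- The generators `A, B, C, D`. -/
noncomputable def gen : Fin 4 → QuantumMatrix q 2 := ![Y q 2 0 0, Y q 2 0 1, Y q 2 1 0, Y q 2 1 1]

lemma gen_relAB : gen q 0 * gen q 1 = q • (gen q 1 * gen q 0) := Y_row q 0 0 1 (by decide)

lemma gen_relAC : gen q 0 * gen q 2 = q • (gen q 2 * gen q 0) := Y_col q 0 1 0 (by decide)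

lemma gen_relBD : gen q 1 * gen q 3 = q • (gen q 3 * gen q 1) := Y_col q 0 1 1 (by decide)

lemma gen_relCD : gen q 2 * gen q 3 = q • (gen q 3 * gen q 2) := Y_row q 1 0 1 (by decide)

lemma gen_relBC : gen q 1 * gen q 2 = gen q 2 * gen q 1 :=
  Y_anti q 0 1 1 0 (by decide) (by decide)

lemma gen_relAD : gen q 0 * gen q 3 = gen q 3 * gen q 0 + (q - q⁻¹) • (gen q 1 * gen q 2) :=
  Y_diag q 0 0 1 1 (by decide) (by decide)

lemma degreeOne_eq_span_gen : degreeOne q 2 = Submodule.span k (Set.range (gen q)) := by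
  unfold degreeOne
  congr 1
  ext a
  constructor
  · rintro ⟨⟨i, j⟩, rfl⟩
    fin_cases i <;> fin_cases j
    exacts [⟨0, rfl⟩, ⟨1, rfl⟩, ⟨2, rfl⟩, ⟨3, rfl⟩]
  · rintro ⟨u, rfl⟩
    fin_cases u
    exacts [⟨(0, 0), rfl⟩, ⟨(0, 1), rfl⟩, ⟨(1, 0), rfl⟩, ⟨(1, 1), rfl⟩]

end generators

/-! ### Bilinear forms on the component of degree one -/

section forms

variable {k : Type*} [Field k]

/-- The Gram matrices, in the basis `A, B, C, D`, of the bilinear forms which vanish on the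
defining relations of `O_q(M_2(k))`. -/
structure IsForm (q : k) (M : Matrix (Fin 4) (Fin 4) k) : Prop where
  AB : M 0 1 = q * M 1 0
  AC : M 0 2 = q * M 2 0
  BD : M 1 3 = q * M 3 1
  CD : M 2 3 = q * M 3 2
  BC : M 1 2 = M 2 1
  AD : M 0 3 = M 3 0 + (q - q⁻¹) * M 1 2

/-- The Gram matrix of a functional in terms of its values on the ordered monomials. -/
def formOf (q : k) (aa ab ac ad bb bc bd cc cd dd : k) : Matrix (Fin 4) (Fin 4) k :=
  !![aa, ab, ac, ad; q⁻¹ * ab, bb, bc, bd; q⁻¹ * ac, bc, cc, cd;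
    ad - (q - q⁻¹) * bc, q⁻¹ * bd, q⁻¹ * cd, dd]

lemma isForm_formOf {q : k} (hq : q ≠ 0) (aa ab ac ad bb bc bd cc cd dd : k) :
    IsForm q (formOf q aa ab ac ad bb bc bd cc cd dd) := by
  constructor <;> simp [formOf, hq]

/-- Left multiplication by a vector `v` of degree one on the truncation in degree `≤ 2`. -/
def truncMul (M : Matrix (Fin 4) (Fin 4) k) (u : Fin 4) :
    Module.End k (k × (Fin 4 → k) × k) where
  toFun p := (0, p.1 • Pi.single u 1, ∑ v, M u v * p.2.1 v)
  map_add' p p' := by simp [add_smul, mul_add, Finset.sum_add_distrib]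
  map_smul' c p := by simp [mul_smul, Finset.mul_sum, mul_left_comm]

lemma truncMul_mul (M : Matrix (Fin 4) (Fin 4) k) (u v : Fin 4) (p : k × (Fin 4 → k) × k) :
    (truncMul M u * truncMul M v) p = (0, 0, M u v * p.1) := by
  simp [truncMul, Pi.single_apply]

/-- The action of `O_q(M_2(k))` on a truncation of itself. -/
noncomputable def truncHom {q : k} {M : Matrix (Fin 4) (Fin 4) k} (hM : IsForm q M) :
    QuantumMatrix q 2 →ₐ[k] Module.End k (k × (Fin 4 → k) × k) :=
  liftTwo (fun i j => truncMul M (![![0, 1], ![2, 3]] i j))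
    (LinearMap.ext fun p => by
      simp only [LinearMap.smul_apply, truncMul_mul]; simp [hM.AB, mul_assoc])
    (LinearMap.ext fun p => by
      simp only [LinearMap.smul_apply, truncMul_mul]; simp [hM.AC, mul_assoc])
    (LinearMap.ext fun p => by
      simp only [LinearMap.smul_apply, truncMul_mul]; simp [hM.BD, mul_assoc])
    (LinearMap.ext fun p => by
      simp only [LinearMap.smul_apply, truncMul_mul]; simp [hM.CD, mul_assoc])
    (by apply LinearMap.ext; intro p; simp only [truncMul_mul]; simp [hM.BC])
    (by
      apply LinearMap.ext; intro p
      simp only [LinearMap.smul_apply, LinearMap.add_apply, truncMul_mul]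
      simp [hM.AD, add_mul, mul_assoc])

@[simp] lemma truncHom_gen {q : k} {M : Matrix (Fin 4) (Fin 4) k} (hM : IsForm q M) (u : Fin 4) :
    truncHom hM (gen q u) = truncMul M u := by
  fin_cases u <;> simp [truncHom, gen]

/-- Apply an element to the vector `(1, 0, 0)` of the truncation and read off the last coordinate.
This needs no basis of the degree-two component. -/
lemma exists_functional {q : k} {M : Matrix (Fin 4) (Fin 4) k} (hM : IsForm q M) :
    ∃ F : QuantumMatrix q 2 →ₗ[k] k, ∀ u v, F (gen q u * gen q v) = M u v := by
  refine ⟨LinearMap.snd k _ _ ∘ₗ LinearMap.snd k _ _ ∘ₗ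
    (LinearMap.applyₗ ((1 : k), (0 : Fin 4 → k), (0 : k))) ∘ₗ (truncHom hM).toLinearMap, ?_⟩
  intro u v
  simp only [LinearMap.comp_apply, AlgHom.toLinearMap_apply, map_mul, truncHom_gen,
    LinearMap.applyₗ_apply_apply]
  rw [truncMul_mul]
  simp

lemma isForm_zero (q : k) : IsForm q 0 := by constructor <;> simp

/-- In the truncation with zero form, the middle coordinate of the image of `(1, 0, 0)` sends the
generators to the standard basis. -/
lemma linearIndependent_gen (q : k) : LinearIndependent k (gen q) := by
  let F : QuantumMatrix q 2 →ₗ[k] (Fin 4 → k) := LinearMap.fst k _ _ ∘ₗ LinearMap.snd k _ _ ∘ₗ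
    (LinearMap.applyₗ ((1 : k), (0 : Fin 4 → k), (0 : k))) ∘ₗ
      (truncHom (isForm_zero q)).toLinearMap
  have hF : F ∘ gen q = Pi.basisFun k (Fin 4) := by
    funext u
    simp [F, truncMul]
  refine LinearIndependent.of_comp F ?_
  rw [hF]
  exact (Pi.basisFun k (Fin 4)).linearIndependent

/-- If `d` is a skew derivation, acting on the generators by the matrix `X`, with respect to a
map `σ` acting by the matrix `S`, the forms compatible with the relations are preserved. -/
lemma IsForm.skewDerivation {q : k} {M : Matrix (Fin 4) (Fin 4) k} (hM : IsForm q M)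
    {d σ : QuantumMatrix q 2 →ₗ[k] QuantumMatrix q 2}
    (hd : ∀ a b, d (a * b) = σ a * d b + d a * b) {S X : Matrix (Fin 4) (Fin 4) k}
    (hS : ∀ u, σ (gen q u) = ∑ v, S v u • gen q v)
    (hX : ∀ u, d (gen q u) = ∑ v, X v u • gen q v) :
    IsForm q (S.transpose * M * X + X.transpose * M) := by
  obtain ⟨F, hF⟩ := exists_functional hM
  have key : ∀ u v, (S.transpose * M * X + X.transpose * M) u v = F (d (gen q u * gen q v)) := by
    intro u v
    rw [hd, hS, hX, hX]
    simp only [map_add, Finset.sum_mul, Finset.mul_sum, map_sum, smul_mul_assoc, mul_smul_comm,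
      map_smul, hF, smul_eq_mul, Matrix.add_apply, Matrix.mul_apply, Matrix.transpose_apply]
    congr 1
    refine Finset.sum_congr rfl fun w _ => ?_
    refine Finset.sum_congr rfl fun w' _ => ?_
    ring
  constructor <;> simp only [key]
  · rw [gen_relAB]; simp
  · rw [gen_relAC]; simp
  · rw [gen_relBD]; simp
  · rw [gen_relCD]; simp
  · rw [gen_relBC]
  · rw [gen_relAD]; simp

end forms

end QuantumMatrix

namespace QuantumMatrix

/-! ### Classification of skew derivations with a diagonal group-like element -/

section classification

variable {k : Type*} [Field k] {q : k}

/-- The exponents of `q` by which the group-like element of each of the ten kinds of skew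
derivations scales `A, B, C, D`. -/
def exps : Fin 10 → Fin 4 → ℤ :=
  ![![-4, -2, -2, 0], ![0, 2, 2, 4], ![1, -1, 1, -1], ![1, 1, -1, -1], ![1, -1, 1, -1],
    ![1, 1, -1, -1], ![-3, -1, -1, 1], ![-3, -1, -1, 1], ![-1, 1, 1, 3], ![-1, 1, 1, 3]]

/-- The generator at which a skew derivation of each kind is surely nonzero. -/
def source : Fin 10 → Fin 4 := ![0, 3, 1, 2, 0, 0, 0, 0, 3, 3]

/-- A generator occurring in the image of `source t`. -/
def target : Fin 10 → Fin 4 := ![3, 0, 0, 0, 1, 2, 1, 2, 1, 2]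

/-- A pair of a diagonal matrix `γ` and a matrix `X` belongs to the kind `t`. -/
structure IsKind (q : k) (γ : Fin 4 → k) (X : Matrix (Fin 4) (Fin 4) k) (t : Fin 10) : Prop where
  diag : ∀ u, γ u = q ^ exps t u
  ne_zero : X (target t) (source t) ≠ 0
  -- The two conditions on the row of `A` serve only to show that the pairs in `noncommuting` do not
  -- commute up to a scalar.
  row_eq_zero : t ∈ ({0, 4, 5} : Finset (Fin 10)) → ∀ u, X 0 u = 0
  row_eq_zero' : t ∈ ({1, 2, 3} : Finset (Fin 10)) → ∀ u, u ≠ source t → X 0 u = 0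
  pow_four : q ^ 4 ≠ 1
  pow_eight : t ∈ ({0, 1} : Finset (Fin 10)) → q ^ 8 ≠ 1

/-- The equations for a skew derivation with diagonal `γ`. -/
structure TorusEquations (q : k) (γ : Fin 4 → k) (X : Matrix (Fin 4) (Fin 4) k) : Prop where
  -- In the field names a letter is the generator being mapped and a digit from 1 to 4 the component
  -- `A, B, C, D` of its image: `b1` concerns the coefficient of `A` in the image of `B`.
  b1 : X 0 1 = 0 ∨ γ 0 = q ∧ γ 2 = q ∧ q * γ 3 = 1
  c1 : X 0 2 = 0 ∨ γ 0 = q ∧ γ 1 = q ∧ q * γ 3 = 1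
  b4 : X 3 1 = 0 ∨ γ 0 = q ∧ q * γ 2 = 1 ∧ q * γ 3 = 1
  c4 : X 3 2 = 0 ∨ γ 0 = q ∧ q * γ 1 = 1 ∧ q * γ 3 = 1
  a4 : X 3 0 = 0 ∨ q ^ 2 * γ 1 = 1 ∧ q ^ 2 * γ 2 = 1 ∧ γ 3 = 1
  d1 : X 0 3 = 0 ∨ γ 1 = q ^ 2 ∧ γ 2 = q ^ 2 ∧ γ 0 = 1
  b3 : X 2 1 = 0
  c2 : X 1 2 = 0
  a2 : X 1 0 = 0 ∨ q * γ 1 = 1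
  a3 : X 2 0 = 0 ∨ q * γ 2 = 1
  d2 : X 1 3 = 0 ∨ γ 1 = q
  d3 : X 2 3 = 0 ∨ γ 2 = q
  a2c4 : X 1 0 * (1 - q * γ 2) + q * X 3 2 * (q - q⁻¹) = 0
  a3b4 : X 2 0 * (1 - q * γ 1) + q * X 3 1 * (q - q⁻¹) = 0
  d3b1 : X 2 3 * (γ 1 - q) + q * γ 3 * X 0 1 * (q - q⁻¹) = 0
  d2c1 : X 1 3 * (γ 2 - q) + q * γ 3 * X 0 2 * (q - q⁻¹) = 0
  a2c4' : X 1 0 * (1 - γ 3 * q⁻¹) - (q - q⁻¹) * γ 1 * X 3 2 = 0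
  a3b4' : q * (X 2 0 * (1 - γ 3 * q⁻¹)) - (q - q⁻¹) * X 3 1 = 0
  d2c1' : q * (X 1 3 * (γ 0 - q⁻¹)) - (q - q⁻¹) * γ 1 * X 0 2 = 0
  d3b1' : X 2 3 * (γ 0 - q⁻¹) - (q - q⁻¹) * X 0 1 = 0

/-- Each conclusion is read off from preservation of the forms dual to the ten ordered monomials.
Most of these conditions involve a single entry of `X`, which is cancelled when nonzero. -/
lemma torusEquations (hq : q ≠ 0) (hq2 : q ^ 2 ≠ 1) {γ : Fin 4 → k} (hγ : ∀ u, γ u ≠ 0)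
    {X : Matrix (Fin 4) (Fin 4) k} (hdiag : ∀ u, X u u = 0)
    (h : ∀ M, IsForm q M →
      IsForm q ((Matrix.diagonal γ).transpose * M * X + X.transpose * M)) :
    TorusEquations q γ X := by
  have hp : q - q⁻¹ ≠ 0 := by
    intro h0
    apply hq2
    field_simp at h0
    linear_combination h0
  have H := fun a b c d e f g i j l => h _ (isForm_formOf hq a b c d e f g i j l)
  have d0 := hdiag 0
  have d1 := hdiag 1
  have d2 := hdiag 2
  have d3 := hdiag 3
  have hγ1 := hγ 1
  have AA := H 1 0 0 0 0 0 0 0 0 0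
  have AB := H 0 1 0 0 0 0 0 0 0 0
  have AC := H 0 0 1 0 0 0 0 0 0 0
  have AD := H 0 0 0 1 0 0 0 0 0 0
  have BB := H 0 0 0 0 1 0 0 0 0 0
  have BC := H 0 0 0 0 0 1 0 0 0 0
  have BD := H 0 0 0 0 0 0 1 0 0 0
  have CC := H 0 0 0 0 0 0 0 1 0 0
  have CD := H 0 0 0 0 0 0 0 0 1 0
  have DD := H 0 0 0 0 0 0 0 0 0 1
  clear H h
  have e : ∀ (M : Matrix (Fin 4) (Fin 4) k) u v,
      ((Matrix.diagonal γ).transpose * M * X + X.transpose * M) u v =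
      γ u * (M u 0 * X 0 v + M u 1 * X 1 v + M u 2 * X 2 v + M u 3 * X 3 v) +
      (X 0 u * M 0 v + X 1 u * M 1 v + X 2 u * M 2 v + X 3 u * M 3 v) := by
    intro M u v
    simp only [Matrix.add_apply, Matrix.diagonal_transpose, Matrix.mul_apply, Fin.sum_univ_four,
      Matrix.transpose_apply,
      Matrix.diagonal_apply]
    fin_cases u <;> simp <;> ring
  -- The letters name the monomial dual to the test form; the digit names the relation tested, in
  -- the order AB, AC, BD, CD, BC, AD.
  obtain ⟨AA1, AA2, AA3, AA4, AA5, AA6⟩ := AA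
  obtain ⟨AB1, AB2, AB3, AB4, AB5, AB6⟩ := AB
  obtain ⟨AC1, AC2, AC3, AC4, AC5, AC6⟩ := AC
  obtain ⟨AD1, AD2, AD3, AD4, AD5, AD6⟩ := AD
  obtain ⟨BB1, BB2, BB3, BB4, BB5, BB6⟩ := BB
  obtain ⟨BC1, BC2, BC3, BC4, BC5, BC6⟩ := BC
  obtain ⟨BD1, BD2, BD3, BD4, BD5, BD6⟩ := BD
  obtain ⟨CC1, CC2, CC3, CC4, CC5, CC6⟩ := CC
  obtain ⟨CD1, CD2, CD3, CD4, CD5, CD6⟩ := CD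
  obtain ⟨DD1, DD2, DD3, DD4, DD5, DD6⟩ := DD
  simp only [e, formOf, d0, d1, d2, d3] at *
  simp [-mul_eq_mul_left_iff, -mul_eq_mul_right_iff, -zero_eq_mul, -mul_eq_zero] at *
  have hr : q * q⁻¹ = 1 := mul_inv_cancel₀ hq
  constructor
  · refine or_iff_not_imp_left.mpr fun hx => ⟨mul_right_cancel₀ hx AA1, mul_right_cancel₀ hx ?_,
      mul_right_cancel₀ hx ?_⟩
    · linear_combination (-q) * AC5 - γ 2 * X 0 1 * hr
    · linear_combination -AD3
  · refine or_iff_not_imp_left.mpr fun hx => ⟨mul_right_cancel₀ hx AA2, mul_right_cancel₀ hx ?_,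
      mul_right_cancel₀ hx ?_⟩
    · linear_combination q * AB5 - γ 1 * X 0 2 * hr
    · linear_combination -AD4
  · refine or_iff_not_imp_left.mpr fun hx => ⟨mul_right_cancel₀ hx AD1, mul_right_cancel₀ hx ?_,
      mul_right_cancel₀ hx ?_⟩
    · linear_combination (-q) * CD5 + X 3 1 * hr
    · linear_combination -DD3
  · refine or_iff_not_imp_left.mpr fun hx => ⟨mul_right_cancel₀ hx AD2, mul_right_cancel₀ hx ?_,
      mul_right_cancel₀ hx ?_⟩
    · linear_combination q * BD5 + X 3 2 * hr
    · linear_combination -DD4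
  · refine or_iff_not_imp_left.mpr fun hx => ⟨mul_right_cancel₀ hx ?_, mul_right_cancel₀ hx ?_,
      mul_right_cancel₀ hx ?_⟩
    · linear_combination (-q) * BD1 + X 3 0 * hr
    · linear_combination (-q) * CD2 + X 3 0 * hr
    · linear_combination -DD6
  · refine or_iff_not_imp_left.mpr fun hx => ⟨mul_right_cancel₀ hx ?_, mul_right_cancel₀ hx ?_,
      mul_right_cancel₀ hx ?_⟩
    · linear_combination q * AB3 - γ 1 * X 0 3 * hr
    · linear_combination q * AC4 - γ 2 * X 0 3 * hr
    · linear_combination AA6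
  · exact (mul_eq_zero.mp CC6.symm).resolve_left hp
  · exact (mul_eq_zero.mp ((mul_eq_zero.mp BB6.symm).resolve_left hp)).resolve_left hγ1
  · exact or_iff_not_imp_left.mpr fun hx => mul_right_cancel₀ hx (by linear_combination -BB1)
  · exact or_iff_not_imp_left.mpr fun hx => mul_right_cancel₀ hx (by linear_combination -CC2)
  · exact or_iff_not_imp_left.mpr fun hx => mul_right_cancel₀ hx BB3
  · exact or_iff_not_imp_left.mpr fun hx => mul_right_cancel₀ hx CC4
  · linear_combination BC2
  · linear_combination BC1
  · linear_combination BC3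
  · linear_combination BC4
  · linear_combination BD6
  · linear_combination q * CD6 + (q - q⁻¹) * X 3 1 * hr
  · linear_combination q * AB6 + (q - q⁻¹) * γ 1 * X 0 2 * hr
  · linear_combination AC6

/-- Take the first nonzero off-diagonal entry in a fixed order. Its equations determine three of the
`γ u`, the rank-one condition `γ 0 * γ 3 = γ 1 * γ 2` gives the fourth, and `l` is the ratio of two
of them, so `l ^ 2 ≠ 1` excludes small orders of `q`. The order of the cases matters: the vanishing
of the row of `A` and the decoupling of the last four kinds use that earlier entries are zero. -/
lemma exists_isKind (hq : q ≠ 0) (hq2 : q ^ 2 ≠ 1) {γ : Fin 4 → k}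
    (hγ : γ 0 * γ 3 = γ 1 * γ 2) {X : Matrix (Fin 4) (Fin 4) k} (hdiag : ∀ u, X u u = 0)
    (hX : X ≠ 0) {l : k} (hl2 : l ^ 2 ≠ 1)
    (hl : ∀ u v, γ v * X v u = l * (X v u * γ u)) (h : TorusEquations q γ X) :
    ∃ t, IsKind q γ X t := by
  have hl1 : l ≠ 1 := by rintro rfl; simp at hl2
  have hl' : ∀ u v, X v u ≠ 0 → γ v = l * γ u := fun u v hx =>
    mul_right_cancel₀ hx (by linear_combination hl u v)
  have hp : q - q⁻¹ ≠ 0 := by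
    intro h0
    apply hq2
    field_simp at h0
    linear_combination h0
  have hq1 : q ≠ 1 := by rintro rfl; simp at hq2
  have d0 := hdiag 0
  by_cases a4 : X 3 0 ≠ 0
  · obtain ⟨e1, e2, e3⟩ := h.a4.resolve_left a4
    have hlv := hl' _ _ a4
    have e0 : γ 0 * q ^ 4 = 1 := by
      linear_combination q ^ 4 * hγ - q ^ 4 * γ 0 * e3 + q ^ 2 * γ 2 * e1 + e2
    have hlq : q ^ 4 = l := by linear_combination -(q ^ 4) * e3 + q ^ 4 * hlv + l * e0
    have b1 : X 0 1 = 0 := h.b1.resolve_right fun h => hq1 (by linear_combination h.2.2 - q * e3)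
    have c1 : X 0 2 = 0 := h.c1.resolve_right fun h => hq1 (by linear_combination h.2.2 - q * e3)
    have d1 : X 0 3 = 0 := h.d1.resolve_right fun h =>
      hl1 (by linear_combination e0 - q ^ 4 * h.2.2 - hlq)
    have g0 := eq_inv_of_mul_eq_one_left e0
    have g1 := eq_inv_of_mul_eq_one_right e1
    have g2 := eq_inv_of_mul_eq_one_right e2
    refine ⟨0, fun u => ?_, a4, fun _ u => ?_, fun ht => absurd ht (by decide),
      fun h4 => hl1 (hlq.symm.trans h4), fun _ h8 => hl2 (by rw [← hlq, ← pow_mul, h8])⟩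
    · fin_cases u <;> simp [exps, zpow_neg, *]
    · fin_cases u <;> assumption
  by_cases d1 : X 0 3 ≠ 0
  · obtain ⟨e1, e2, e0⟩ := h.d1.resolve_left d1
    have hlv := hl' _ _ d1
    have e3 : γ 3 = q ^ 4 := by rw [e0, e1, e2] at hγ; linear_combination hγ
    have hlq : l * q ^ 4 = 1 := by rw [← e3, ← hlv, e0]
    have b1 : X 0 1 = 0 := h.b1.resolve_right fun h => hq1 (by rw [← h.1, e0])
    have c1 : X 0 2 = 0 := h.c1.resolve_right fun h => hq1 (by rw [← h.1, e0])
    refine ⟨1, fun u => ?_, d1, fun ht => absurd ht (by decide), fun _ u hu => ?_,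
      fun h4 => hl1 (by simpa [h4] using hlq), fun _ h8 => hl2 ?_⟩
    · fin_cases u <;> simp [exps, e0, e1, e2, e3]
    · fin_cases u <;> first | assumption | exact absurd rfl hu
    · linear_combination (l * q ^ 4 + 1) * hlq - l ^ 2 * h8
  by_cases b1 : X 0 1 ≠ 0
  · obtain ⟨e0, e2, e3⟩ := h.b1.resolve_left b1
    have hlv := hl' _ _ b1
    have e1 : γ 1 * q = 1 := by rw [e2, e0] at hγ; linear_combination e3 - hγ
    have hlq : q ^ 2 = l := by rw [e0] at hlv; linear_combination q * hlv + l * e1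
    have c1 : X 0 2 = 0 := h.c1.resolve_right fun h =>
      hq2 (by rw [h.2.1] at e1; linear_combination e1)
    have g1 := eq_inv_of_mul_eq_one_left e1
    have g3 := eq_inv_of_mul_eq_one_right e3
    refine ⟨2, fun u => ?_, b1, fun ht => absurd ht (by decide), fun _ u hu => ?_,
      fun h4 => hl2 (by rw [← hlq, ← pow_mul, h4]), fun ht => absurd ht (by decide)⟩
    · fin_cases u <;> simp [exps, zpow_neg, e0, e2, g1, g3]
    · fin_cases u <;> first | assumption | exact absurd rfl hu | exact not_not.mp d1
  by_cases c1 : X 0 2 ≠ 0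
  · obtain ⟨e0, e1, e3⟩ := h.c1.resolve_left c1
    have hlv := hl' _ _ c1
    have e2 : γ 2 * q = 1 := by rw [e1, e0] at hγ; linear_combination e3 - hγ
    have hlq : q ^ 2 = l := by rw [e0] at hlv; linear_combination q * hlv + l * e2
    have b1 : X 0 1 = 0 := h.b1.resolve_right fun h =>
      hq2 (by rw [h.2.1] at e2; linear_combination e2)
    have g2 := eq_inv_of_mul_eq_one_left e2
    have g3 := eq_inv_of_mul_eq_one_right e3
    refine ⟨3, fun u => ?_, c1, fun ht => absurd ht (by decide), fun _ u hu => ?_,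
      fun h4 => hl2 (by rw [← hlq, ← pow_mul, h4]), fun ht => absurd ht (by decide)⟩
    · fin_cases u <;> simp [exps, zpow_neg, e0, e1, g2, g3]
    · fin_cases u <;> first | assumption | exact absurd rfl hu | exact not_not.mp d1
  by_cases c4 : X 3 2 ≠ 0
  · obtain ⟨e0, e1, e3⟩ := h.c4.resolve_left c4
    have hlv := hl' _ _ c4
    have e2 : γ 2 = q := by
      rw [e0] at hγ; linear_combination (-q) * hγ + q * e3 - γ 2 * e1
    have hlq : l * q ^ 2 = 1 := by rw [e2] at hlv; linear_combination e3 - q * hlv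
    -- The component `C ↦ D` never occurs alone: it forces `A ↦ B`, which then serves as the
    -- distinguished entry of the kind.
    have hx : X 1 0 ≠ 0 := by
      intro hx
      have := h.a2c4
      simp [hx, hq, c4, hp] at this
    have g1 := eq_inv_of_mul_eq_one_right e1
    have g3 := eq_inv_of_mul_eq_one_right e3
    refine ⟨4, fun u => ?_, hx, fun _ u => ?_, fun ht => absurd ht (by decide),
      fun h4 => hl2 ?_, fun ht => absurd ht (by decide)⟩
    · fin_cases u <;> simp [exps, zpow_neg, e0, e2, g1, g3]
    · fin_cases u <;> first | assumption | (apply not_not.mp; assumption)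
    · linear_combination (l * q ^ 2 + 1) * hlq - l ^ 2 * h4
  by_cases b4 : X 3 1 ≠ 0
  · obtain ⟨e0, e2, e3⟩ := h.b4.resolve_left b4
    have hlv := hl' _ _ b4
    have e1 : γ 1 = q := by
      rw [e0] at hγ; linear_combination (-q) * hγ + q * e3 - γ 1 * e2
    have hlq : l * q ^ 2 = 1 := by rw [e1] at hlv; linear_combination e3 - q * hlv
    have hx : X 2 0 ≠ 0 := by
      intro hx
      have := h.a3b4
      simp [hx, hq, b4, hp] at this
    have g2 := eq_inv_of_mul_eq_one_right e2
    have g3 := eq_inv_of_mul_eq_one_right e3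
    refine ⟨5, fun u => ?_, hx, fun _ u => ?_, fun ht => absurd ht (by decide),
      fun h4 => hl2 ?_, fun ht => absurd ht (by decide)⟩
    · fin_cases u <;> simp [exps, zpow_neg, e0, e1, g2, g3]
    · fin_cases u <;> first | assumption | (apply not_not.mp; assumption)
    · linear_combination (l * q ^ 2 + 1) * hlq - l ^ 2 * h4
  -- From here on the partner entry in each coupled equation is already zero, so these equations
  -- become conditions on `γ`.
  by_cases a2 : X 1 0 ≠ 0
  · have hlv := hl' _ _ a2
    have e1 := h.a2.resolve_left a2
    have e2 : q * γ 2 = 1 := by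
      have := h.a2c4
      simp only [not_not.mp c4, mul_zero, zero_mul, add_zero, mul_eq_zero, a2, false_or] at this
      linear_combination -this
    have e3 : γ 3 = q := by
      have := h.a2c4'
      simp only [not_not.mp c4, mul_zero, sub_zero, mul_eq_zero, a2, false_or] at this
      field_simp at this
      linear_combination -this
    have e0 : γ 0 * q ^ 3 = 1 := by
      rw [e3] at hγ; linear_combination q ^ 2 * hγ + q * γ 2 * e1 + e2
    have hlq : q ^ 2 = l := by linear_combination q ^ 3 * hlv - q ^ 2 * e1 + l * e0
    have g0 := eq_inv_of_mul_eq_one_left e0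
    have g1 := eq_inv_of_mul_eq_one_right e1
    have g2 := eq_inv_of_mul_eq_one_right e2
    refine ⟨6, fun u => ?_, a2, fun ht => absurd ht (by decide), fun ht => absurd ht (by decide),
      fun h4 => hl2 (by rw [← hlq, ← pow_mul, h4]), fun ht => absurd ht (by decide)⟩
    fin_cases u <;> simp [exps, zpow_neg, g0, g1, g2, e3]
  by_cases a3 : X 2 0 ≠ 0
  · have hlv := hl' _ _ a3
    have e2 := h.a3.resolve_left a3
    have e1 : q * γ 1 = 1 := by
      have := h.a3b4
      simp only [not_not.mp b4, mul_zero, zero_mul, add_zero, mul_eq_zero, a3, false_or] at this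
      linear_combination -this
    have e3 : γ 3 = q := by
      have := h.a3b4'
      simp only [not_not.mp b4, mul_zero, sub_zero, mul_eq_zero, a3, hq, false_or] at this
      field_simp at this
      linear_combination -this
    have e0 : γ 0 * q ^ 3 = 1 := by
      rw [e3] at hγ; linear_combination q ^ 2 * hγ + q * γ 2 * e1 + e2
    have hlq : q ^ 2 = l := by linear_combination q ^ 3 * hlv - q ^ 2 * e2 + l * e0
    have g0 := eq_inv_of_mul_eq_one_left e0
    have g1 := eq_inv_of_mul_eq_one_right e1
    have g2 := eq_inv_of_mul_eq_one_right e2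
    refine ⟨7, fun u => ?_, a3, fun ht => absurd ht (by decide), fun ht => absurd ht (by decide),
      fun h4 => hl2 (by rw [← hlq, ← pow_mul, h4]), fun ht => absurd ht (by decide)⟩
    fin_cases u <;> simp [exps, zpow_neg, g0, g1, g2, e3]
  by_cases d2 : X 1 3 ≠ 0
  · have hlv := hl' _ _ d2
    have e1 := h.d2.resolve_left d2
    have e2 : γ 2 = q := by
      have := h.d2c1
      simp only [not_not.mp c1, mul_zero, zero_mul, add_zero, mul_eq_zero, d2, false_or] at this
      linear_combination this
    have e0 : γ 0 = q⁻¹ := by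
      have := h.d2c1'
      simp only [not_not.mp c1, mul_zero, sub_zero, mul_eq_zero, d2, hq, false_or] at this
      linear_combination this
    have e3 : γ 3 = q ^ 3 := by
      rw [e0, e1, e2] at hγ
      field_simp at hγ
      linear_combination hγ
    have hlq : l * q ^ 2 = 1 := by
      rw [e1, e3] at hlv
      refine mul_left_cancel₀ hq ?_
      linear_combination -hlv
    refine ⟨8, fun u => ?_, d2, fun ht => absurd ht (by decide), fun ht => absurd ht (by decide),
      fun h4 => hl2 ?_, fun ht => absurd ht (by decide)⟩
    · fin_cases u <;> simp [exps, zpow_neg, e0, e1, e2, e3]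
    · linear_combination (l * q ^ 2 + 1) * hlq - l ^ 2 * h4
  by_cases d3 : X 2 3 ≠ 0
  · have hlv := hl' _ _ d3
    have e2 := h.d3.resolve_left d3
    have e1 : γ 1 = q := by
      have := h.d3b1
      simp only [not_not.mp b1, mul_zero, zero_mul, add_zero, mul_eq_zero, d3, false_or] at this
      linear_combination this
    have e0 : γ 0 = q⁻¹ := by
      have := h.d3b1'
      simp only [not_not.mp b1, mul_zero, sub_zero, mul_eq_zero, d3, false_or] at this
      linear_combination this
    have e3 : γ 3 = q ^ 3 := by
      rw [e0, e1, e2] at hγ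
      field_simp at hγ
      linear_combination hγ
    have hlq : l * q ^ 2 = 1 := by
      rw [e2, e3] at hlv
      refine mul_left_cancel₀ hq ?_
      linear_combination -hlv
    refine ⟨9, fun u => ?_, d3, fun ht => absurd ht (by decide), fun ht => absurd ht (by decide),
      fun h4 => hl2 ?_, fun ht => absurd ht (by decide)⟩
    · fin_cases u <;> simp [exps, zpow_neg, e0, e1, e2, e3]
    · linear_combination (l * q ^ 2 + 1) * hlq - l ^ 2 * h4
  -- The ten entries just excluded, the diagonal, and the entries `B ↦ C`, `C ↦ B` exhaust the
  -- matrix.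
  exfalso
  apply hX
  push Not at *
  ext u v
  fin_cases u <;> fin_cases v <;>
    first | assumption | exact hdiag _ | exact h.b3 | exact h.c2
end classification
end QuantumMatrix

namespace QuantumMatrix

/-! ### Exclusion of group-like elements acting through the transposition -/

section transpose

variable {k : Type*} [Field k] {q : k}

/-- The permutation of the indices of `A, B, C, D` induced by the transposition. -/
def swapBC : Fin 4 → Fin 4 := ![0, 2, 1, 3]

/-- The matrix of `γ` composed with the transposition. -/
def swapMatrix (γ : Fin 4 → k) : Matrix (Fin 4) (Fin 4) k :=
  Matrix.of fun v u => if v = swapBC u then γ u else 0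

lemma swapMatrix_transpose_mul (γ : Fin 4 → k) (M : Matrix (Fin 4) (Fin 4) k) (u v : Fin 4) :
    ((swapMatrix γ).transpose * M) u v = γ u * M (swapBC u) v := by
  simp [swapMatrix, Matrix.mul_apply]

/-- Commutation up to `l` permutes the entries of `X` with scalars. On the corner entries `X 0 0`,
`X 3 3` and on the central block a return to the same entry multiplies by `l` or `l ^ 2`, neither of
which is 1, so those six entries vanish. Preservation of five test forms kills the other ten. -/
lemma eq_zero_of_swapMatrix (hq : q ≠ 0) (hq2 : q ^ 2 ≠ 1) {γ : Fin 4 → k} (hγ : ∀ u, γ u ≠ 0)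
    {X : Matrix (Fin 4) (Fin 4) k} {l : k} (hl2 : l ^ 2 ≠ 1)
    (hl : swapMatrix γ * X = l • (X * swapMatrix γ))
    (h : ∀ M, IsForm q M →
      IsForm q ((swapMatrix γ).transpose * M * X + X.transpose * M)) : X = 0 := by
  have hl1 : l ≠ 1 := by rintro rfl; simp at hl2
  have hp : q - q⁻¹ ≠ 0 := by
    intro h0
    apply hq2
    field_simp at h0
    linear_combination h0
  have hl' : ∀ u v, γ (swapBC v) * X (swapBC v) u = l * (X v (swapBC u) * γ u) := by
    intro u v
    have h1 : ∀ w, v = swapBC w ↔ w = swapBC v := by revert v; decide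
    have := congrFun (congrFun hl v) u
    simpa [swapMatrix, Matrix.mul_apply, h1] using this
  have g0 := hγ 0
  have g1 := hγ 1
  have g2 := hγ 2
  have g3 := hγ 3
  have cancel : ∀ {g c x : k}, g ≠ 0 → c ≠ 1 → g * x = c * (x * g) → x = 0 := by
    intro g c x hg hc h
    by_contra hx
    exact hc (mul_right_cancel₀ (mul_ne_zero hg hx) (by linear_combination -h))
  have x00 : X 0 0 = 0 := cancel g0 hl1 (hl' 0 0)
  have x33 : X 3 3 = 0 := cancel g3 hl1 (hl' 3 3)
  have h11 : γ 2 * X 2 1 = l * (X 1 2 * γ 1) := hl' 1 1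
  have h22 : γ 1 * X 1 2 = l * (X 2 1 * γ 2) := hl' 2 2
  have h12 : γ 2 * X 2 2 = l * (X 1 1 * γ 2) := hl' 2 1
  have h21 : γ 1 * X 1 1 = l * (X 2 2 * γ 1) := hl' 1 2
  -- The two antidiagonal entries are exchanged, so going around once produces `l ^ 2`; the same
  -- happens for `X 1 1` and `X 2 2`.
  have x12 : X 1 2 = 0 := cancel g1 hl2 (by linear_combination h22 + l * h11)
  have x21 : X 2 1 = 0 := cancel g2 hl2 (by linear_combination h11 + l * h22)
  have e22 : X 2 2 = l * X 1 1 := mul_left_cancel₀ g2 (by linear_combination h12)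
  have x11 : X 1 1 = 0 := cancel g1 hl2 (by rw [e22] at h21; linear_combination h21)
  have x22 : X 2 2 = 0 := by rw [e22, x11, mul_zero]
  have H := fun a b c d e f g i j l => h _ (isForm_formOf hq a b c d e f g i j l)
  have BB := H 0 0 0 0 1 0 0 0 0 0
  have BC := H 0 0 0 0 0 1 0 0 0 0
  have BD := H 0 0 0 0 0 0 1 0 0 0
  have CC := H 0 0 0 0 0 0 0 1 0 0
  have AB := H 0 1 0 0 0 0 0 0 0 0
  clear H h hl hl'
  have e : ∀ (M : Matrix (Fin 4) (Fin 4) k) u v,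
      ((swapMatrix γ).transpose * M * X + X.transpose * M) u v =
      γ u * (M (swapBC u) 0 * X 0 v + M (swapBC u) 1 * X 1 v + M (swapBC u) 2 * X 2 v +
        M (swapBC u) 3 * X 3 v) +
      (X 0 u * M 0 v + X 1 u * M 1 v + X 2 u * M 2 v + X 3 u * M 3 v) := by
    intro M u v
    rw [Matrix.add_apply, Matrix.mul_apply, Matrix.mul_apply]
    simp only [swapMatrix_transpose_mul, Fin.sum_univ_four, Matrix.transpose_apply]
    ring
  have AB3 := AB.BD
  have BB1 := BB.AB
  have BB4 := BB.CD
  have BC1 := BC.AB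
  have BC2 := BC.AC
  have BC3 := BC.BD
  have BC4 := BC.CD
  have BD1 := BD.AB
  have CC2 := CC.AC
  have CC3 := CC.BD
  simp only [e, formOf, swapBC, x00, x11, x22, x33, x12, x21, Matrix.cons_val,
    Matrix.of_apply] at AB3 BB1 BB4 BC1 BC2 BC3 BC4 BD1 CC2 CC3
  have x10 : X 1 0 = 0 := by linear_combination BB1
  have x20 : X 2 0 = 0 := by linear_combination CC2
  have x03 : X 0 3 = 0 := by simpa [hq, eq_comm] using AB3
  have x13 : X 1 3 = 0 := by simpa [g2] using BB4
  have x23 : X 2 3 = 0 := by simpa [g1] using CC3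
  have x30 : X 3 0 = 0 := by simpa [hq] using BD1
  have hp' : q⁻¹ - q ≠ 0 := fun h => hp (by linear_combination -h)
  have x31 : X 3 1 = 0 := by simpa [x10, x20, hq, hp', eq_comm] using BC1
  have x32 : X 3 2 = 0 := by simpa [x10, x20, hq, hp', eq_comm] using BC2
  have x01 : X 0 1 = 0 := by simpa [x13, x23, hq, hp', g3, eq_comm] using BC3
  have x02 : X 0 2 = 0 := by simpa [x13, x23, hq, hp', g3, eq_comm] using BC4
  ext u v
  fin_cases u <;> fin_cases v <;> assumption

end transpose

/-! ### Matrices of the elements of 𝓗 ⋊ ⟨τ⟩ -/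

section torus

variable {k : Type*} [Field k] {q : k} {N : ℕ}

/-- The automorphisms of these two shapes already form a subgroup, and it contains 𝓗 and τ. -/
lemma exists_of_mem_torusTranspose {φ : QuantumMatrix q N ≃ₐ[k] QuantumMatrix q N}
    (hφ : φ ∈ torusTranspose q N) : ∃ a b : Fin N → kˣ,
      (∀ i j, φ (Y q N i j) = ((a i : k) * b j) • Y q N i j) ∨
      (∀ i j, φ (Y q N i j) = ((a i : k) * b j) • Y q N j i) := by
  let K : Subgroup (QuantumMatrix q N ≃ₐ[k] QuantumMatrix q N) :=
    { carrier := {φ | ∃ a b : Fin N → kˣ,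
        (∀ i j, φ (Y q N i j) = ((a i : k) * b j) • Y q N i j) ∨
        (∀ i j, φ (Y q N i j) = ((a i : k) * b j) • Y q N j i)}
      one_mem' := ⟨1, 1, Or.inl fun i j => by simp⟩
      mul_mem' := by
        rintro φ ψ ⟨a, b, h⟩ ⟨a', b', h'⟩
        rcases h with h | h <;> rcases h' with h' | h'
        · refine ⟨a * a', b * b', Or.inl fun i j => ?_⟩
          simp [h', h, smul_smul, mul_mul_mul_comm, mul_comm]
        · refine ⟨b * a', a * b', Or.inr fun i j => ?_⟩
          simp [h', h, smul_smul, mul_mul_mul_comm, mul_comm]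
        · refine ⟨a * a', b * b', Or.inr fun i j => ?_⟩
          simp [h', h, smul_smul, mul_mul_mul_comm, mul_comm]
        · refine ⟨b * a', a * b', Or.inl fun i j => ?_⟩
          simp [h', h, smul_smul, mul_mul_mul_comm, mul_comm]
      inv_mem' := by
        rintro φ ⟨a, b, h | h⟩
        · refine ⟨a⁻¹, b⁻¹, Or.inl fun i j => φ.injective ?_⟩
          rw [map_smul, h, smul_smul, ← AlgEquiv.mul_apply, mul_inv_cancel, AlgEquiv.one_apply]
          simp [mul_mul_mul_comm]
        · refine ⟨b⁻¹, a⁻¹, Or.inr fun i j => φ.injective ?_⟩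
          rw [map_smul, h, smul_smul, ← AlgEquiv.mul_apply, mul_inv_cancel, AlgEquiv.one_apply]
          simp [mul_comm (a j : k), mul_mul_mul_comm] }
  have hK : torusTranspose q N ≤ K := by
    refine sup_le ?_ ?_
    · rintro φ ⟨a, b, h⟩
      exact ⟨a, b, Or.inl h⟩
    · rw [Subgroup.zpowers_le]
      refine ⟨1, 1, Or.inr fun i j => ?_⟩
      change transposeHom q _ = _
      simp
  exact hK hφ

lemma exists_matrix_of_mem_torusTranspose {φ : QuantumMatrix q 2 ≃ₐ[k] QuantumMatrix q 2}
    (hφ : φ ∈ torusTranspose q 2) : ∃ γ : Fin 4 → k, (∀ u, γ u ≠ 0) ∧ γ 0 * γ 3 = γ 1 * γ 2 ∧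
      ∃ S : Matrix (Fin 4) (Fin 4) k, (S = Matrix.diagonal γ ∨ S = swapMatrix γ) ∧
        ∀ u, φ (gen q u) = ∑ v, S v u • gen q v := by
  obtain ⟨a, b, h⟩ := exists_of_mem_torusTranspose hφ
  refine ⟨![a 0 * b 0, a 0 * b 1, a 1 * b 0, a 1 * b 1], ?_, ?_, ?_⟩
  · intro u
    fin_cases u <;> simp
  · simp
    ring
  rcases h with h | h
  · refine ⟨_, Or.inl rfl, fun u => ?_⟩
    simp only [Matrix.diagonal_apply, ite_smul, zero_smul, Finset.sum_ite_eq', Finset.mem_univ,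
      if_true]
    fin_cases u <;> simp [gen, h]
  · refine ⟨_, Or.inr rfl, fun u => ?_⟩
    simp only [swapMatrix, Matrix.of_apply, ite_smul, zero_smul, Finset.sum_ite_eq',
      Finset.mem_univ, if_true]
    fin_cases u <;> simp [gen, swapBC, h]

end torus

/-! ### Which kinds of skew derivations can coexist -/

section pairs

variable {k : Type*} [Field k] {q : k}

/-- The exponent of `q` that has to vanish for two kinds of skew derivations to coexist. -/
def weight (t t' : Fin 10) : ℤ :=
  exps t (target t') + exps t' (target t) - exps t (source t') - exps t' (source t)

/-- The pairs of kinds which are compatible with the weights, but do not commute. -/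
def noncommuting : List (Fin 10 × Fin 10) := [(0, 1), (4, 2), (5, 3)]

/-- Whether two kinds of skew derivations can occur together. -/
def compatible (t t' : Fin 10) : Bool :=
  weight t t' ∉ ([2, -2, 4, -4, 8, -8] : List ℤ) ∧ (t, t') ∉ noncommuting ∧
    (t', t) ∉ noncommuting

/-- A finite check. Repetitions are harmless: the weight of a kind with itself is `±4` or `±8`, so
no kind is compatible with itself. -/
lemma not_four_compatible : ∀ a b : Fin 10, compatible a b → ∀ c, compatible a c →
    compatible b c → ∀ d, compatible a d → compatible b d → ¬ compatible c d := by
  decide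

/-- Evaluating the eigenvalue relations at the distinguished entries writes `c` and `c'` as powers
of `q`, and `c * c' = 1` becomes `q ^ weight = 1`. The exceptional pairs have weight zero and are
excluded by the commutation relation instead. -/
lemma IsKind.compatible (hq : q ≠ 0) (hq2 : q ^ 2 ≠ 1) {γ γ' : Fin 4 → k}
    {X X' : Matrix (Fin 4) (Fin 4) k} {t t' : Fin 10} (h : IsKind q γ X t)
    (h' : IsKind q γ' X' t') {c c' : k} (hc : c * c' = 1)
    (e : ∀ u v, γ v * X' v u = c * (X' v u * γ u))
    (e' : ∀ u v, γ' v * X v u = c' * (X v u * γ' u))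
    (hX : X * X' = c • (X' * X)) : compatible t t' := by
  have hw : q ^ weight t t' = 1 := by
    have h1 : q ^ exps t (target t') = c * q ^ exps t (source t') := by
      rw [← h.diag, ← h.diag]
      exact mul_right_cancel₀ h'.ne_zero (by linear_combination e (source t') (target t'))
    have h2 : q ^ exps t' (target t) = c' * q ^ exps t' (source t) := by
      rw [← h'.diag, ← h'.diag]
      exact mul_right_cancel₀ h.ne_zero (by linear_combination e' (source t) (target t))
    rw [weight, zpow_sub₀ hq, zpow_sub₀ hq, zpow_add₀ hq, h1, h2, div_div,
      div_eq_one_iff_eq (mul_ne_zero (zpow_ne_zero _ hq) (zpow_ne_zero _ hq))]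
    linear_combination q ^ exps t (source t') * q ^ exps t' (source t) * hc
  have hmem : weight t t' ∉ ([2, -2, 4, -4, 8, -8] : List ℤ) := by
    intro hm
    -- `q ^ 8 ≠ 1` is known only for kinds 0 and 1, and weight `±8` occurs only there.
    have h8 : weight t t' = 8 ∨ weight t t' = -8 → t ∈ ({0, 1} : Finset (Fin 10)) := by
      revert t t'; intro t t' _ _ _ _
      clear * -
      revert t t'
      decide
    simp only [List.mem_cons, List.not_mem_nil, or_false] at hm
    rcases hm with hm | hm | hm | hm | hm | hm
    · rw [hm] at hw; exact hq2 (mod_cast hw)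
    · rw [hm, zpow_neg, inv_eq_one] at hw; exact hq2 (mod_cast hw)
    · rw [hm] at hw; exact h.pow_four (mod_cast hw)
    · rw [hm, zpow_neg, inv_eq_one] at hw; exact h.pow_four (mod_cast hw)
    · rw [hm] at hw; exact h.pow_eight (h8 (Or.inl hm)) (mod_cast hw)
    · rw [hm, zpow_neg, inv_eq_one] at hw; exact h.pow_eight (h8 (Or.inr hm)) (mod_cast hw)
  have comm : ∀ {γ γ' : Fin 4 → k} {X X' : Matrix (Fin 4) (Fin 4) k} {t t' : Fin 10} {c : k},
      IsKind q γ X t → IsKind q γ' X' t' → c ≠ 0 → X * X' = c • (X' * X) →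
      (t, t') ∉ noncommuting := by
    clear * -
    intro γ γ' X X' t t' c h h' hc hX ht
    have h1 : t ∈ ({0, 4, 5} : Finset (Fin 10)) ∧ t' ∈ ({1, 2, 3} : Finset (Fin 10)) ∧
        target t' = 0 ∧ source t = 0 ∧ target t = source t' := by
      clear * - ht
      revert t t'
      decide
    obtain ⟨ht, ht', e1, e2, e3⟩ := h1
    -- Compare the coefficients of `A` in the images of `A`: that of `X * X'` is zero since `X` has
    -- zero first row, while that of `X' * X` is the product of the two distinguished entries.
    have h2 := congrFun (congrFun hX 0) 0
    rw [Matrix.mul_apply, Finset.sum_eq_zero fun u _ => by rw [h.row_eq_zero ht, zero_mul],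
      Matrix.smul_apply, Matrix.mul_apply, Finset.sum_eq_single (source t')
        (fun u _ hu => by rw [h'.row_eq_zero' ht' u hu, zero_mul]) (by simp)] at h2
    have h3 := h.ne_zero
    have h4 := h'.ne_zero
    rw [e1] at h4
    rw [e2, e3] at h3
    exact smul_ne_zero hc (mul_ne_zero h4 h3) h2.symm
  have hc0 : c ≠ 0 := left_ne_zero_of_mul_eq_one hc
  have hX' : X' * X = c⁻¹ • (X * X') := by rw [hX, smul_smul, inv_mul_cancel₀ hc0, one_smul]
  simp only [QuantumMatrix.compatible, decide_eq_true_eq]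
  exact ⟨hmem, comm h h' hc0 hX, comm h' h (inv_ne_zero hc0) hX'⟩

end pairs

end QuantumMatrix

namespace QuantumMatrix

/-! ### The upper bound on the rank -/

section bound

variable {k : Type*} [Field k] {q : k} {G : Type*} [CommGroup G] {θ : ℕ}
  {D : QuantumLinearDatum k G θ}

lemma act_x_mul {A : Type*} [Ring A] [Algebra k A] (ρ : HopfAction k D.Bosonization A) (i : Fin θ)
    (a b : A) : ρ.act (D.x i) (a * b) =
      ρ.act (D.grp (D.g i)) a * ρ.act (D.x i) b + ρ.act (D.x i) a * b := by
  rw [ρ.act_mul, D.comul_eq, D.comulHom_x]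
  simp

lemma act_x_one {A : Type*} [Ring A] [Algebra k A] (ρ : HopfAction k D.Bosonization A)
    (i : Fin θ) : ρ.act (D.x i) 1 = 0 := by
  rw [ρ.act_one, D.counit_eq, D.counitHom_x, map_zero]

lemma mul_apply_gen {f g : Module.End k (QuantumMatrix q 2)} {F F' : Matrix (Fin 4) (Fin 4) k}
    (hf : ∀ u, f (gen q u) = ∑ v, F v u • gen q v)
    (hg : ∀ u, g (gen q u) = ∑ v, F' v u • gen q v) (u : Fin 4) :
    (f * g) (gen q u) = ∑ v, (F * F') v u • gen q v := by
  simp only [Module.End.mul_apply, hg, map_sum, map_smul, hf, Finset.smul_sum, smul_smul,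
    Matrix.mul_apply, Finset.sum_smul]
  rw [Finset.sum_comm]
  simp only [mul_comm]

/-- Linear independence of the generators transfers relations between operators to their matrices.
-/
lemma mul_eq_smul_mul_of_gen {f g : Module.End k (QuantumMatrix q 2)}
    {F F' : Matrix (Fin 4) (Fin 4) k} {c : k} (h : f * g = c • (g * f))
    (hf : ∀ u, f (gen q u) = ∑ v, F v u • gen q v)
    (hg : ∀ u, g (gen q u) = ∑ v, F' v u • gen q v) : F * F' = c • (F' * F) := by
  ext v u
  have h1 : ∑ v, (F * F') v u • gen q v = ∑ v, (c • (F' * F)) v u • gen q v := by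
    rw [← mul_apply_gen hf hg, h, LinearMap.smul_apply, mul_apply_gen hg hf, Finset.smul_sum]
    simp only [smul_smul, Matrix.smul_apply, smul_eq_mul]
  have := linearIndependent_iff'.mp (linearIndependent_gen q) Finset.univ
    (fun v => (F * F') v u - (c • (F' * F)) v u)
    (by simp only [sub_smul, Finset.sum_sub_distrib, h1, sub_self]) v (Finset.mem_univ v)
  exact sub_eq_zero.mp this

/-- The shape of a skew derivation belonging to an admissible action. -/
lemma IsAdmissible.exists_isKind {ρ : HopfAction k D.Bosonization (QuantumMatrix q 2)}
    (hρ : IsAdmissible q 2 D ρ) (hq : q ≠ 0) (hq2 : q ^ 2 ≠ 1) (i : Fin θ) (hm : D.m i ≠ 2) :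
    ∃ (γ : Fin 4 → k) (X : Matrix (Fin 4) (Fin 4) k) (t : Fin 10), IsKind q γ X t ∧
      (∀ u, ρ.act (D.grp (D.g i)) (gen q u) = ∑ v, Matrix.diagonal γ v u • gen q v) ∧
      ∀ u, ρ.act (D.x i) (gen q u) = ∑ v, X v u • gen q v := by
  obtain ⟨φ, hφ, hg⟩ := hρ.grp_mem i
  obtain ⟨γ, hγ, hγ', S, hS, hφS⟩ := exists_matrix_of_mem_torusTranspose hφ
  have hgS : ∀ u, ρ.act (D.grp (D.g i)) (gen q u) = ∑ v, S v u • gen q v := fun u => by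
    rw [hg, hφS]
  have hlin : ∀ u, ∃ c : Fin 4 → k, ∑ v, c v • gen q v = ρ.act (D.x i) (gen q u) := fun u => by
    have := hρ.linear i (gen q u) (by
      rw [degreeOne_eq_span_gen]
      exact Submodule.subset_span ⟨u, rfl⟩)
    rw [degreeOne_eq_span_gen] at this
    exact (Submodule.mem_span_range_iff_exists_fun k).mp this
  choose Xt hXt using hlin
  set X : Matrix (Fin 4) (Fin 4) k := Matrix.of fun v u => Xt u v with hXdef
  have hX : ∀ u, ρ.act (D.x i) (gen q u) = ∑ v, X v u • gen q v := fun u => (hXt u).symm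
  have hX0 : X ≠ 0 := by
    intro h0
    refine hρ.ne_zero i (eq_zero_of_skewDerivation _ _ _ (act_x_mul ρ i) (act_x_one ρ i) ?_)
    have h : ∀ u, ρ.act (D.x i) (gen q u) = 0 := fun u => by simp [hX, h0]
    intro a b
    fin_cases a <;> fin_cases b
    exacts [h 0, h 1, h 2, h 3]
  -- This is where `m_i ≠ 2` enters: with `2 ≤ m_i` it excludes orders 1 and 2.
  have hl2 : (D.χ i (D.g i) : k) ^ 2 ≠ 1 := by
    intro h
    have h1 : D.χ i (D.g i) ^ 2 = 1 := by
      ext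
      simpa using h
    have h2 := orderOf_le_of_pow_eq_one two_pos h1
    have h3 := D.two_le i
    exact hm (le_antisymm h2 h3)
  have heig : S * X = (D.χ i (D.g i) : k) • (X * S) := by
    refine mul_eq_smul_mul_of_gen ?_ hgS hX
    rw [← map_mul, D.grp_mul_x, map_smul, map_mul]
  have hform : ∀ M, IsForm q M → IsForm q (S.transpose * M * X + X.transpose * M) :=
    fun M hM => hM.skewDerivation (act_x_mul ρ i) hgS hX
  rcases hS with rfl | rfl
  · have hl : ∀ u v, γ v * X v u = (D.χ i (D.g i) : k) * (X v u * γ u) := fun u v => by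
      simpa using congrFun (congrFun heig v) u
    have hl1 : (D.χ i (D.g i) : k) ≠ 1 := by
      intro h
      simp [h] at hl2
    -- A diagonal entry commutes with conjugation by `γ`, whereas `x_i` is scaled by `l ≠ 1`.
    have hdiag : ∀ u, X u u = 0 := fun u => by
      by_contra hx
      exact hl1 (mul_right_cancel₀ (mul_ne_zero (hγ u) hx) (by linear_combination -hl u u))
    obtain ⟨t, ht⟩ := QuantumMatrix.exists_isKind hq hq2 hγ' hdiag hX0 hl2 hl
      (torusEquations hq hq2 hγ hdiag hform)
    exact ⟨γ, X, t, ht, hgS, hX⟩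
  · exact absurd (eq_zero_of_swapMatrix hq hq2 hγ hl2 heig hform) hX0

/-- Distinct indices have compatible kinds, so four of them would contradict `not_four_compatible`.
-/
theorem IsAdmissible.rank_le {ρ : HopfAction k D.Bosonization (QuantumMatrix q 2)}
    (hρ : IsAdmissible q 2 D ρ) (hq : q ≠ 0) (hq2 : q ^ 2 ≠ 1) (hm : ∀ i, D.m i ≠ 2) :
    θ ≤ 3 := by
  choose γ X t ht hg hX using fun i => hρ.exists_isKind hq hq2 i (hm i)
  have key : ∀ i j, i ≠ j → compatible (t i) (t j) := by
    have he : ∀ i j u v, γ i v * X j v u = (D.χ j (D.g i) : k) * (X j v u * γ i u) := by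
      intro i j u v
      have := mul_eq_smul_mul_of_gen (c := (D.χ j (D.g i) : k))
        (by rw [← map_mul, D.grp_mul_x, map_smul, map_mul]) (hg i) (hX j)
      simpa using congrFun (congrFun this v) u
    intro i j hij
    refine (ht i).compatible hq hq2 (ht j) (c := (D.χ j (D.g i) : k))
      (c' := (D.χ i (D.g j) : k)) ?_ (he i j) (he j i) ?_
    · rw [D.compat i j hij, ← Units.val_mul, mul_inv_cancel, Units.val_one]
    · exact mul_eq_smul_mul_of_gen (by rw [← map_mul, D.x_mul_x hij, map_smul, map_mul])
        (hX i) (hX j)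
  by_contra! hθ
  let f : Fin 4 → Fin θ := Fin.castLE hθ
  have hf : ∀ a b, a ≠ b → compatible (t (f a)) (t (f b)) := fun a b hab =>
    key _ _ fun h => hab (Fin.castLE_injective hθ h)
  exact not_four_compatible _ _ (hf 0 1 (by decide)) _ (hf 0 2 (by decide)) (hf 1 2 (by decide))
    _ (hf 0 3 (by decide)) (hf 1 3 (by decide)) (hf 2 3 (by decide))

end bound

end QuantumMatrix

/-! ### Hopf actions from automorphisms and skew derivations -/

section HopfActions

variable {k : Type*} [Field k] {A : Type*} [Ring A] [Algebra k A]

/-- `σ`-skew derivations `d`, i.e. linear maps with `d (a b) = σ(a) d(b) + d(a) b`. -/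
def IsSkewDerivation (σ d : Module.End k A) : Prop :=
  ∀ a b, d (a * b) = σ a * d b + d a * b

lemma IsSkewDerivation.map_one {σ d : Module.End k A} (h : IsSkewDerivation σ d) (hσ : σ 1 = 1) :
    d 1 = 0 := by
  have := h 1 1
  rw [mul_one, hσ, one_mul, mul_one] at this
  simpa using this

/-- If `σ d = l d σ` with `l` of order `n`, the power `d ^ n` is a skew derivation. -/
lemma IsSkewDerivation.pow_orderOf {σ d : Module.End k A} (h : IsSkewDerivation σ d) {l : kˣ}
    (hl : 2 ≤ orderOf l) (hd : σ * d = (l : k) • (d * σ)) :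
    IsSkewDerivation (σ ^ orderOf l) (d ^ orderOf l) := by
  -- The skew Leibniz rule says that `d` composed with multiplication is multiplication composed
  -- with `P + R`. Since `P` and `R` commute up to `l`, only the outer terms of the Gaussian
  -- binomial expansion of `(P + R) ^ n` survive.
  set P : Module.End k (A ⊗[k] A) := TensorProduct.map σ d
  set R : Module.End k (A ⊗[k] A) := TensorProduct.map d 1
  have hPR : P * R = (l : k) • (R * P) := by
    simp only [P, R]
    rw [← TensorProduct.map_mul, ← TensorProduct.map_mul, hd, mul_one, one_mul,
      TensorProduct.map_smul_left]
  have hmul : ∀ (n : ℕ) z, (d ^ n) (LinearMap.mul' k A z) =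
      LinearMap.mul' k A (((P + R) ^ n) z) := by
    intro n
    induction n with
    | zero => simp
    | succ n ih =>
      intro z
      rw [pow_succ, Module.End.mul_apply, pow_succ, Module.End.mul_apply, ← ih]
      congr 1
      induction z with
      | zero => simp
      | add z w hz hw => simp only [map_add, hz, hw]
      | tmul a b => simp [P, R, h a b]
  intro a b
  have := hmul (orderOf l) (a ⊗ₜ b)
  rw [QuantumLinearDatum.add_pow_orderOf hPR hl] at this
  simp only [P, R, TensorProduct.map_pow, one_pow] at this
  simpa using this

variable {G : Type*} [CommGroup G] {θ : ℕ} {D : QuantumLinearDatum k G θ}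

/-- A representation of a bosonization in which `G` acts by automorphisms and the `x_i` by skew
derivations is a Hopf action. -/
noncomputable def QuantumLinearDatum.hopfAction (act : D.Bosonization →ₐ[k] Module.End k A)
    (h_one : ∀ h, act (D.grp h) 1 = 1)
    (h_mul : ∀ h a b, act (D.grp h) (a * b) = act (D.grp h) a * act (D.grp h) b)
    (hx : ∀ i, IsSkewDerivation (act (D.grp (D.g i))) (act (D.x i))) :
    HopfAction k D.Bosonization A where
  act := act
  act_one h := by
    rw [D.counit_eq]
    induction h using D.induction with
    | hg h => simp [h_one]
    | hx i => simpa using (hx i).map_one (h_one _)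
    | hc c => simp [Algebra.algebraMap_eq_smul_one]
    | hadd a b ha hb => simp [ha, hb]
    | hmul a b ha hb =>
      rw [map_mul, Module.End.mul_apply, hb, Algebra.algebraMap_eq_smul_one, map_smul, ha,
        map_mul, map_mul, ← Algebra.smul_def, Algebra.algebraMap_eq_smul_one, smul_comm,
        Algebra.algebraMap_eq_smul_one]
  act_mul h a b := by
    let E : D.Bosonization →ₐ[k] Module.End k (A ⊗[k] A) :=
      (Module.endTensorEndAlgHom.comp (Algebra.TensorProduct.map act act)).comp D.comulHom
    let L : D.Bosonization →ₗ[k] A →ₗ[k] A := act.toLinearMap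
    have hE : ∀ (z : D.Bosonization ⊗[k] D.Bosonization) (a b : A),
        LinearMap.mul' k A (TensorProduct.map (L.flip a) (L.flip b) z) =
          LinearMap.mul' k A (Module.endTensorEndAlgHom (R := k) (S := k) (A := k) (M := A) (N := A)
            (Algebra.TensorProduct.map act act z) (a ⊗ₜ[k] b)) := by
      intro z a b
      induction z with
      | zero => simp
      | add z w hz hw => simp only [map_add, hz, hw, LinearMap.add_apply]
      | tmul s t => simp [L, Module.endTensorEndAlgHom_apply]
    -- Stated for every tensor `z`, compatibility with multiplication is stable under products in
    -- `h`, because `E` is an algebra homomorphism; hence generators suffice.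
    have key : ∀ z, act h (LinearMap.mul' k A z) = LinearMap.mul' k A (E h z) := by
      induction h using D.induction with
      | hg h =>
        intro z
        induction z with
        | zero => simp
        | add z w hz hw => simp only [map_add, hz, hw]
        | tmul a b => simp [E, h_mul, Module.endTensorEndAlgHom_apply]
      | hx i =>
        intro z
        induction z with
        | zero => simp
        | add z w hz hw => simp only [map_add, hz, hw]
        | tmul a b => simp [E, hx i a b, Module.endTensorEndAlgHom_apply]
      | hc c => intro z; simp [Algebra.algebraMap_eq_smul_one]
      | hadd a b ha hb => intro z; simp [ha, hb]
      | hmul a b ha hb => intro z; simp [ha, hb]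
    rw [D.comul_eq]
    refine Eq.trans ?_ (hE _ a b).symm
    simpa [E] using key (a ⊗ₜ b)

end HopfActions

namespace QuantumMatrix

/-! ### Construction of skew derivations and torus endomorphisms -/

section skewDerivations

variable {k : Type*} [Field k] {q : k}

/-- A σ-skew derivation is the upper right entry of an algebra homomorphism into triangular 2 × 2
matrices with diagonal entries `σ a` and `a`. The hypotheses are the upper right entries of the six
relations. -/
lemma exists_isSkewDerivation (σ : QuantumMatrix q 2 →ₐ[k] QuantumMatrix q 2)
    (y : Fin 2 → Fin 2 → QuantumMatrix q 2)
    (hAB : σ (Y q 2 0 0) * y 0 1 + y 0 0 * Y q 2 0 1 =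
      q • (σ (Y q 2 0 1) * y 0 0 + y 0 1 * Y q 2 0 0))
    (hAC : σ (Y q 2 0 0) * y 1 0 + y 0 0 * Y q 2 1 0 =
      q • (σ (Y q 2 1 0) * y 0 0 + y 1 0 * Y q 2 0 0))
    (hBD : σ (Y q 2 0 1) * y 1 1 + y 0 1 * Y q 2 1 1 =
      q • (σ (Y q 2 1 1) * y 0 1 + y 1 1 * Y q 2 0 1))
    (hCD : σ (Y q 2 1 0) * y 1 1 + y 1 0 * Y q 2 1 1 =
      q • (σ (Y q 2 1 1) * y 1 0 + y 1 1 * Y q 2 1 0))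
    (hBC : σ (Y q 2 0 1) * y 1 0 + y 0 1 * Y q 2 1 0 =
      σ (Y q 2 1 0) * y 0 1 + y 1 0 * Y q 2 0 1)
    (hAD : σ (Y q 2 0 0) * y 1 1 + y 0 0 * Y q 2 1 1 =
      σ (Y q 2 1 1) * y 0 0 + y 1 1 * Y q 2 0 0 +
        (q - q⁻¹) • (σ (Y q 2 0 1) * y 1 0 + y 0 1 * Y q 2 1 0)) :
    ∃ d : Module.End k (QuantumMatrix q 2), IsSkewDerivation σ.toLinearMap d ∧
      ∀ i j, d (Y q 2 i j) = y i j := by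
  have h1 := fun f : QuantumMatrix q 2 →ₐ[k] QuantumMatrix q 2 => congrArg f (gen_relAB (q := q))
  have h2 := fun f : QuantumMatrix q 2 →ₐ[k] QuantumMatrix q 2 => congrArg f (gen_relAC (q := q))
  have h3 := fun f : QuantumMatrix q 2 →ₐ[k] QuantumMatrix q 2 => congrArg f (gen_relBD (q := q))
  have h4 := fun f : QuantumMatrix q 2 →ₐ[k] QuantumMatrix q 2 => congrArg f (gen_relCD (q := q))
  have h5 := fun f : QuantumMatrix q 2 →ₐ[k] QuantumMatrix q 2 => congrArg f (gen_relBC (q := q))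
  have h6 := fun f : QuantumMatrix q 2 →ₐ[k] QuantumMatrix q 2 => congrArg f (gen_relAD (q := q))
  simp only [gen, Matrix.cons_val, map_mul, map_smul, map_add] at h1 h2 h3 h4 h5 h6
  let ψ : QuantumMatrix q 2 →ₐ[k] Matrix (Fin 2) (Fin 2) (QuantumMatrix q 2) :=
    liftTwo (fun i j => !![σ (Y q 2 i j), y i j; 0, Y q 2 i j])
      (by simpa [Matrix.mul_fin_two, Matrix.smul_of, h1 σ, hAB] using h1 (AlgHom.id k _))
      (by simpa [Matrix.mul_fin_two, Matrix.smul_of, h2 σ, hAC] using h2 (AlgHom.id k _))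
      (by simpa [Matrix.mul_fin_two, Matrix.smul_of, h3 σ, hBD] using h3 (AlgHom.id k _))
      (by simpa [Matrix.mul_fin_two, Matrix.smul_of, h4 σ, hCD] using h4 (AlgHom.id k _))
      (by simpa [Matrix.mul_fin_two, Matrix.smul_of, h5 σ, hBC] using h5 (AlgHom.id k _))
      (by simpa [Matrix.mul_fin_two, Matrix.smul_of, h6 σ, hAD] using h6 (AlgHom.id k _))
  have hψ : ∀ a, ψ a 0 0 = σ a ∧ ψ a 1 0 = 0 ∧ ψ a 1 1 = a := by
    intro a
    induction a using induction with
    | hY i j => simp [ψ]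
    | hc c => simp [Matrix.algebraMap_matrix_apply]
    | hadd a b ha hb => simp [ha, hb]
    | hmul a b ha hb => simp [ha, hb, Matrix.mul_apply]
  refine ⟨Matrix.entryLinearMap k _ 0 1 ∘ₗ ψ.toLinearMap, fun a b => ?_, fun i j => ?_⟩
  · simp [Matrix.mul_apply, hψ]
  · simp [ψ]

/-- The endomorphism of `O_q(M_2(k))` which multiplies `Y_{ij}` by `a_i b_j`. -/
noncomputable def torusHom (q : k) (a b : Fin 2 → k) :
    QuantumMatrix q 2 →ₐ[k] QuantumMatrix q 2 :=
  liftTwo (fun i j => (a i * b j) • Y q 2 i j)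
    (by
      simp only [smul_mul_smul_comm, smul_comm q, Y_row (N := 2) q 0 0 1 (by decide)]
      congr 1; ring)
    (by
      simp only [smul_mul_smul_comm, smul_comm q, Y_col (N := 2) q 0 1 0 (by decide)]
      congr 1; ring)
    (by
      simp only [smul_mul_smul_comm, smul_comm q, Y_col (N := 2) q 0 1 1 (by decide)]
      congr 1; ring)
    (by
      simp only [smul_mul_smul_comm, smul_comm q, Y_row (N := 2) q 1 0 1 (by decide)]
      congr 1; ring)
    (by
      simp only [smul_mul_smul_comm, Y_anti (N := 2) q 0 1 1 0 (by decide) (by decide)]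
      congr 1; ring)
    (by
      simp only [smul_mul_smul_comm, Y_diag (N := 2) q 0 0 1 1 (by decide) (by decide), smul_add,
        smul_smul]
      congr 2 <;> ring_nf)

@[simp] lemma torusHom_Y (a b : Fin 2 → k) (i j : Fin 2) :
    torusHom q a b (Y q 2 i j) = (a i * b j) • Y q 2 i j := liftTwo_Y ..

lemma torusHom_comp (a b a' b' : Fin 2 → k) :
    (torusHom q a b).comp (torusHom q a' b') = torusHom q (a * a') (b * b') := by
  refine algHom_ext q fun i j => ?_
  simp [smul_smul]
  congr 1
  ring

lemma torusHom_one : torusHom q 1 1 = AlgHom.id k _ :=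
  algHom_ext q fun i j => by simp

end skewDerivations

end QuantumMatrix

namespace QuantumMatrix

/-! ### Three explicit skew derivations -/

section skewDerivationExamples

variable {k : Type*} [Field k] {q : k}

/-- Rewriting rules to ordered monomials, which reduce the identities below to comparisons of
scalars. -/
lemma Y_mul_normalForm (hq : q ≠ 0) :
    Y q 2 0 1 * Y q 2 0 0 = q⁻¹ • (Y q 2 0 0 * Y q 2 0 1) ∧
    Y q 2 1 0 * Y q 2 0 0 = q⁻¹ • (Y q 2 0 0 * Y q 2 1 0) ∧
    Y q 2 1 1 * Y q 2 0 1 = q⁻¹ • (Y q 2 0 1 * Y q 2 1 1) ∧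
    Y q 2 1 1 * Y q 2 1 0 = q⁻¹ • (Y q 2 1 0 * Y q 2 1 1) ∧
    Y q 2 1 0 * Y q 2 0 1 = Y q 2 0 1 * Y q 2 1 0 ∧
    Y q 2 1 1 * Y q 2 0 0 =
      Y q 2 0 0 * Y q 2 1 1 - (q - q⁻¹) • (Y q 2 0 1 * Y q 2 1 0) := by
  refine ⟨?_, ?_, ?_, ?_, ?_, ?_⟩
  · exact (eq_inv_smul_iff₀ hq).mpr (gen_relAB (q := q)).symm
  · exact (eq_inv_smul_iff₀ hq).mpr (gen_relAC (q := q)).symm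
  · exact (eq_inv_smul_iff₀ hq).mpr (gen_relBD (q := q)).symm
  · exact (eq_inv_smul_iff₀ hq).mpr (gen_relCD (q := q)).symm
  · exact (gen_relBC (q := q)).symm
  · exact eq_sub_of_add_eq (gen_relAD (q := q)).symm

/-- The skew derivation with `A ↦ D` and `B, C, D ↦ 0`. -/
lemma exists_skewDerivation_diag (hq : q ≠ 0) {a b : Fin 2 → k} (h1 : q ^ 2 * (a 0 * b 1) = 1)
    (h2 : q ^ 2 * (a 1 * b 0) = 1) (h3 : a 1 * b 1 = 1) :
    ∃ d : Module.End k (QuantumMatrix q 2), IsSkewDerivation (torusHom q a b).toLinearMap d ∧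
      ∀ i j, d (Y q 2 i j) = ![![Y q 2 1 1, 0], ![0, 0]] i j := by
  obtain ⟨-, -, r3, r4, -, -⟩ := Y_mul_normalForm hq
  replace h1 := eq_inv_of_mul_eq_one_right h1
  replace h2 := eq_inv_of_mul_eq_one_right h2
  refine exists_isSkewDerivation _ _ ?_ ?_ ?_ ?_ ?_ ?_ <;>
    simp [h1, h2, h3, r3, r4, smul_smul] <;> match_scalars <;> field_simp

/-- The skew derivation with `A ↦ B`, `C ↦ D` and `B, D ↦ 0`. -/
lemma exists_skewDerivation_row (hq : q ≠ 0) {a b : Fin 2 → k} (h0 : a 0 * b 0 = q)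
    (h1 : q * (a 0 * b 1) = 1) (h2 : a 1 * b 0 = q) (h3 : q * (a 1 * b 1) = 1) :
    ∃ d : Module.End k (QuantumMatrix q 2), IsSkewDerivation (torusHom q a b).toLinearMap d ∧
      ∀ i j, d (Y q 2 i j) = ![![Y q 2 0 1, 0], ![Y q 2 1 1, 0]] i j := by
  obtain ⟨-, -, r3, -, r5, r6⟩ := Y_mul_normalForm hq
  replace h1 := eq_inv_of_mul_eq_one_right h1
  replace h3 := eq_inv_of_mul_eq_one_right h3
  refine exists_isSkewDerivation _ _ ?_ ?_ ?_ ?_ ?_ ?_ <;>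
    simp [h0, h1, h2, h3, r3, r5, r6, smul_smul] <;> match_scalars <;> field_simp <;>
    ring

/-- The skew derivation with `A ↦ C`, `B ↦ D` and `C, D ↦ 0`. -/
lemma exists_skewDerivation_col (hq : q ≠ 0) {a b : Fin 2 → k} (h0 : a 0 * b 0 = q)
    (h1 : a 0 * b 1 = q) (h2 : q * (a 1 * b 0) = 1) (h3 : q * (a 1 * b 1) = 1) :
    ∃ d : Module.End k (QuantumMatrix q 2), IsSkewDerivation (torusHom q a b).toLinearMap d ∧
      ∀ i j, d (Y q 2 i j) = ![![Y q 2 1 0, Y q 2 1 1], ![0, 0]] i j := by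
  obtain ⟨-, -, -, r4, r5, r6⟩ := Y_mul_normalForm hq
  replace h2 := eq_inv_of_mul_eq_one_right h2
  replace h3 := eq_inv_of_mul_eq_one_right h3
  refine exists_isSkewDerivation _ _ ?_ ?_ ?_ ?_ ?_ ?_ <;>
    simp [h0, h1, h2, h3, r4, r5, r6, smul_smul] <;> match_scalars <;> field_simp <;>
    ring

end skewDerivationExamples

/-! ### Actions of bosonizations whose group acts through the torus -/

section torusActions

variable {k : Type*} [Field k] {q : k} {G : Type*} [CommGroup G] {θ : ℕ}
  {D : QuantumLinearDatum k G θ}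

/-- For each relation involving some `x_i`, the difference of its two sides acts as a twisted
derivation that kills 1, so it vanishes once it vanishes on the generators. -/
lemma exists_hopfAction (α β : Fin 2 → G →* kˣ) (y : Fin θ → Module.End k (QuantumMatrix q 2))
    (hy : ∀ i, IsSkewDerivation
      (torusHom q (fun s => α s (D.g i)) (fun s => β s (D.g i))).toLinearMap (y i))
    (hpow : ∀ i a b, (y i ^ D.m i) (Y q 2 a b) = 0)
    (hmul : ∀ i j, i ≠ j → ∀ a b,
      y i (y j (Y q 2 a b)) = (D.χ j (D.g i) : k) • y j (y i (Y q 2 a b)))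
    (hwt : ∀ h i a b, torusHom q (fun s => α s h) (fun s => β s h) (y i (Y q 2 a b)) =
      ((D.χ i h * (α a h * β b h) : kˣ) : k) • y i (Y q 2 a b)) :
    ∃ ρ : HopfAction k D.Bosonization (QuantumMatrix q 2),
      (∀ h, ρ.act (D.grp h) = (torusHom q (fun s => α s h) (fun s => β s h)).toLinearMap) ∧
      ∀ i, ρ.act (D.x i) = y i := by
  set f : G → Module.End k (QuantumMatrix q 2) := fun h =>
    (torusHom q (fun s => α s h) (fun s => β s h)).toLinearMap with hf
  have hfY : ∀ h a b, f h (Y q 2 a b) = ((α a h : k) * β b h) • Y q 2 a b := fun h a b => by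
    simp [hf]
  have hf_mul : ∀ h a b, f h (a * b) = f h a * f h b := fun h a b => by simp [hf]
  have hf_one : ∀ h, f h 1 = 1 := fun h => by simp [hf]
  have f_mul : ∀ h h', f h * f h' = f (h * h') := by
    intro h h'
    simp only [hf, Module.End.mul_eq_comp]
    rw [← AlgHom.comp_toLinearMap, torusHom_comp]
    congr 2 <;> ext s <;> simp
  have f_one : f 1 = 1 := by
    have : f 1 = (torusHom q 1 1).toLinearMap := by
      simp only [hf]
      congr 2 <;> ext s <;> simp
    rw [this, torusHom_one]
    rfl
  have hy' : ∀ i a b, y i (a * b) = f (D.g i) a * y i b + y i a * b := hy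
  have hy1 : ∀ i, y i 1 = 0 := fun i => (hy i).map_one (hf_one _)
  have f_comm : ∀ h h' a, f h (f h' a) = f h' (f h a) := fun h h' a => by
    rw [← Module.End.mul_apply, f_mul, mul_comm, ← f_mul, Module.End.mul_apply]
  have f_mul_y : ∀ h i, f h * y i = (D.χ i h : k) • (y i * f h) := by
    intro h i
    rw [← sub_eq_zero]
    refine eq_zero_of_skewDerivation _ (fun a => f h (f (D.g i) a)) (f h) (fun a b => ?_)
      (by simp [hy1, hf_one]) (fun a b => ?_)
    · simp only [LinearMap.sub_apply, LinearMap.smul_apply, Module.End.mul_apply, hy', hf_mul,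
        map_add, f_comm h, mul_sub, sub_mul, smul_add, mul_smul_comm, smul_mul_assoc]
      abel
    · simp only [LinearMap.sub_apply, LinearMap.smul_apply, Module.End.mul_apply, hfY, map_smul]
      rw [sub_eq_zero, smul_smul]
      simpa [hf] using hwt h i a b
  have fy : ∀ h i a, f h (y i a) = (D.χ i h : k) • y i (f h a) := fun h i a =>
    congrArg (fun T => T a) (f_mul_y h i)
  have y_pow : ∀ i, y i ^ D.m i = 0 := by
    intro i
    -- `m_i` is the order of `χ_i(g_i)`, exactly the exponent for which the power is again a skew
    -- derivation.
    have := (hy i).pow_orderOf (l := D.χ i (D.g i)) (D.two_le i) (f_mul_y _ _)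
    refine eq_zero_of_skewDerivation _ _ id this ?_ (hpow i)
    refine this.map_one ?_
    change (f (D.g i) ^ _) 1 = 1
    induction orderOf (D.χ i (D.g i)) with
    | zero => simp
    | succ n ih => rw [pow_succ, Module.End.mul_apply, hf_one, ih]
  have y_mul : ∀ i j, i ≠ j → y i * y j = (D.χ j (D.g i) : k) • (y j * y i) := by
    intro i j hij
    have hc : (D.χ j (D.g i) : k) * D.χ i (D.g j) = 1 := by
      rw [D.compat i j hij, ← Units.val_mul, mul_inv_cancel, Units.val_one]
    rw [← sub_eq_zero]
    -- The mixed terms of the two Leibniz expansions cancel because `χ_j(g_i) χ_i(g_j) = 1`.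
    refine eq_zero_of_skewDerivation _ (fun a => f (D.g i) (f (D.g j) a)) id (fun a b => ?_)
      (by simp [hy1]) (fun a b => ?_)
    · simp only [LinearMap.sub_apply, LinearMap.smul_apply, Module.End.mul_apply, hy',
        map_add, f_comm (D.g j), fy, mul_sub, sub_mul, smul_add, mul_smul_comm, smul_mul_assoc,
        smul_smul, hc, one_smul, id]
      abel
    · simp [hmul i j hij]
  let act := D.lift f y f_one f_mul y_pow y_mul f_mul_y
  have h1 : ∀ h, act (D.grp h) = f h := fun h => D.lift_grp ..
  have h2 : ∀ i, act (D.x i) = y i := fun i => D.lift_x ..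
  exact ⟨D.hopfAction act (fun h => by rw [h1, hf_one]) (fun h a b => by rw [h1, hf_mul])
    (fun i => by rw [h1, h2]; exact hy i), h1, h2⟩

end torusActions

/-! ### The example of rank three at a primitive fifth root of unity -/

section rankThree

variable {k : Type*} [Field k]

/-- The character of `(ℤ/n)^r` with exponents `w` with respect to an `n`-th root of unity `ζ`. -/
def expChar {n r : ℕ} {ζ : kˣ} (hζ : ζ ^ n = 1) (w : Fin r → ℤ) :
    Multiplicative (Fin r → ZMod n) →* kˣ where
  toFun h := ζ ^ ((fun i => (w i : ZMod n)) ⬝ᵥ h.toAdd).cast (R := ℤ)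
  map_one' := by simp
  map_mul' h h' := by
    rw [toAdd_mul, dotProduct_add, ← zpow_add, zpow_eq_zpow_iff_modEq]
    -- Integer lifts are additive only modulo `n`; this suffices since the order of `ζ` divides `n`.
    refine Int.ModEq.of_dvd (Int.natCast_dvd_natCast.mpr (orderOf_dvd_of_pow_eq_one hζ)) ?_
    rw [← ZMod.intCast_eq_intCast_iff]
    simp

lemma expChar_apply {n r : ℕ} {ζ : kˣ} (hζ : ζ ^ n = 1) (w : Fin r → ℤ)
    (h : Multiplicative (Fin r → ZMod n)) :
    expChar hζ w h = ζ ^ ((fun i => (w i : ZMod n)) ⬝ᵥ h.toAdd).cast (R := ℤ) := rfl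

lemma expChar_add {n r : ℕ} {ζ : kˣ} (hζ : ζ ^ n = 1) (w w' : Fin r → ℤ)
    (h : Multiplicative (Fin r → ZMod n)) :
    expChar hζ (w + w') h = expChar hζ w h * expChar hζ w' h := by
  rw [expChar_apply, expChar_apply, expChar_apply, ← zpow_add, zpow_eq_zpow_iff_modEq]
  refine Int.ModEq.of_dvd (Int.natCast_dvd_natCast.mpr (orderOf_dvd_of_pow_eq_one hζ)) ?_
  rw [← ZMod.intCast_eq_intCast_iff]
  have : (fun i => (((w + w') i : ℤ) : ZMod n)) =
      (fun i => (w i : ZMod n)) + fun i => (w' i : ZMod n) := by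
    ext i
    simp
  rw [this, add_dotProduct]
  simp

lemma expChar_single {n r : ℕ} {ζ : kˣ} (hζ : ζ ^ n = 1) (w : Fin r → ℤ) (i : Fin r) :
    expChar hζ w (Multiplicative.ofAdd (Pi.single i 1)) = ζ ^ w i := by
  rw [expChar_apply, toAdd_ofAdd, dotProduct_single, mul_one, zpow_eq_zpow_iff_modEq]
  refine Int.ModEq.of_dvd (Int.natCast_dvd_natCast.mpr (orderOf_dvd_of_pow_eq_one hζ)) ?_
  rw [← ZMod.intCast_eq_intCast_iff]
  simp

/-- The exponents of the characters `χ_j` on the generators of `(ℤ/5)^3`. -/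
def chiExp : Fin 3 → Fin 3 → ℤ := ![![4, -2, -2], ![2, -2, 0], ![2, 0, -2]]

/-- The exponents of the characters by which `(ℤ/5)^3` scales the rows. -/
def rowExp : Fin 2 → Fin 3 → ℤ := ![![-2, 0, 1], ![0, 0, -1]]

/-- The exponents of the characters by which `(ℤ/5)^3` scales the columns. -/
def colExp : Fin 2 → Fin 3 → ℤ := ![![-2, 1, 0], ![0, -1, 0]]

lemma orderOf_zpow_chiExp {ζ : kˣ} (hζ : orderOf ζ = 5) (i : Fin 3) :
    orderOf (ζ ^ chiExp i i) = 5 := by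
  have hp : Fact (Nat.Prime 5) := ⟨by norm_num⟩
  refine orderOf_eq_prime ?_ ?_
  · rw [← zpow_natCast, ← zpow_mul, mul_comm, zpow_mul, zpow_natCast, ← hζ, pow_orderOf_eq_one,
      one_zpow]
  · rw [Ne, ← orderOf_dvd_iff_zpow_eq_one, hζ]
    revert i
    decide

/-- The quantum linear space of rank three over `(ℤ/5)^3`. -/
def rankThreeDatum {ζ : kˣ} (hζ : orderOf ζ = 5) :
    QuantumLinearDatum k (Multiplicative (Fin 3 → ZMod 5)) 3 where
  g i := Multiplicative.ofAdd (Pi.single i 1)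
  χ j := expChar (hζ ▸ pow_orderOf_eq_one ζ) (chiExp j)
  compat i j hij := by
    rw [expChar_single, expChar_single, ← zpow_neg]
    congr 1
    revert i j
    decide
  two_le i := by
    rw [expChar_single, orderOf_zpow_chiExp hζ]
    norm_num

lemma rankThreeDatum_χ_g {ζ : kˣ} (hζ : orderOf ζ = 5) (i j : Fin 3) :
    (rankThreeDatum hζ).χ j ((rankThreeDatum hζ).g i) = ζ ^ chiExp j i :=
  expChar_single (by rw [← hζ, pow_orderOf_eq_one]) _ _

lemma rankThreeDatum_m {ζ : kˣ} (hζ : orderOf ζ = 5) (i : Fin 3) :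
    (rankThreeDatum hζ).m i = 5 := by
  rw [QuantumLinearDatum.m, rankThreeDatum_χ_g, orderOf_zpow_chiExp hζ]

lemma exists_mem_torusTranspose_eq_torusHom {q : k} (a b : Fin 2 → kˣ) : ∃ φ ∈ torusTranspose q 2,
    ∀ x, torusHom q (fun s => a s) (fun s => b s) x = φ x := by
  refine ⟨AlgEquiv.ofAlgHom (torusHom q (fun s => a s) (fun s => b s))
    (torusHom q (fun s => ((a s)⁻¹ : kˣ)) (fun s => ((b s)⁻¹ : kˣ)))
    (algHom_ext q fun i j => ?_) (algHom_ext q fun i j => ?_), ?_, fun x => rfl⟩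
  · simp [smul_smul, mul_mul_mul_comm]
  · simp [smul_smul, mul_mul_mul_comm _ _ (a i : k)⁻¹]
  · exact Subgroup.mem_sup_left ⟨a, b, fun i j => torusHom_Y ..⟩

/-- The values of the three skew derivations on the generators: `A ↦ D`; `A ↦ B`, `C ↦ D`;
`A ↦ C`, `B ↦ D`. -/
noncomputable def rankThreeImage (q : k) : Fin 3 → Fin 2 → Fin 2 → QuantumMatrix q 2 :=
  ![![![Y q 2 1 1, 0], ![0, 0]], ![![Y q 2 0 1, 0], ![Y q 2 1 1, 0]],
    ![![Y q 2 1 0, Y q 2 1 1], ![0, 0]]]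

/-- The three skew derivations are of kinds 0, 4 and 5. The sums of `rowExp` and `colExp` reproduce
the corresponding rows of `exps`, and `chiExp` records by how much each derivation shifts these
exponents. -/
theorem exists_isAdmissible_rankThree (ζ : kˣ) (hζ : orderOf ζ = 5) :
    ∃ ρ : HopfAction k (rankThreeDatum hζ).Bosonization (QuantumMatrix (ζ : k) 2),
      IsAdmissible (ζ : k) 2 (rankThreeDatum hζ) ρ := by
  have h5 : ζ ^ 5 = 1 := hζ ▸ pow_orderOf_eq_one ζ
  set q : k := (ζ : k) with hq
  let α : Fin 2 → Multiplicative (Fin 3 → ZMod 5) →* kˣ := fun s => expChar h5 (rowExp s)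
  let β : Fin 2 → Multiplicative (Fin 3 → ZMod 5) →* kˣ := fun s => expChar h5 (colExp s)
  have hαβ : ∀ i s t, ((α s ((rankThreeDatum hζ).g i) : kˣ) : k) * β t ((rankThreeDatum hζ).g i) =
      q ^ (rowExp s i + colExp t i) := by
    intro i s t
    have h1 : α s ((rankThreeDatum hζ).g i) = ζ ^ rowExp s i := expChar_single ..
    have h2 : β t ((rankThreeDatum hζ).g i) = ζ ^ colExp t i := expChar_single ..
    rw [h1, h2, ← Units.val_mul, ← zpow_add, hq, Units.val_zpow_eq_zpow_val]
  have hq0 : q ≠ 0 := ζ.ne_zero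
  have hd : ∀ i, ∃ d : Module.End k (QuantumMatrix q 2),
      IsSkewDerivation (torusHom q (fun s => α s ((rankThreeDatum hζ).g i))
        (fun s => β s ((rankThreeDatum hζ).g i))).toLinearMap d ∧
      ∀ a b, d (Y q 2 a b) = rankThreeImage q i a b := by
    intro i
    fin_cases i
    · refine exists_skewDerivation_diag hq0 ?_ ?_ ?_ <;> rw [hαβ] <;>
        simp [rowExp, colExp, zpow_neg, hq0]
    · refine exists_skewDerivation_row hq0 ?_ ?_ ?_ ?_ <;> rw [hαβ] <;>
        simp [rowExp, colExp, zpow_neg, hq0]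
    · refine exists_skewDerivation_col hq0 ?_ ?_ ?_ ?_ <;> rw [hαβ] <;>
        simp [rowExp, colExp, zpow_neg, hq0]
  choose y hy hyY using hd
  have hwt : ∀ h i a b, torusHom q (fun s => α s h) (fun s => β s h) (y i (Y q 2 a b)) =
      (((rankThreeDatum hζ).χ i h * (α a h * β b h) : kˣ) : k) • y i (Y q 2 a b) := by
    intro h i a b
    have e : ∀ {j s t s' t'}, chiExp j + (rowExp s + colExp t) = rowExp s' + colExp t' →
        (rankThreeDatum hζ).χ j h * (α s h * β t h) = α s' h * β t' h := by
      intro j s t s' t' he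
      change expChar h5 _ h * (expChar h5 _ h * expChar h5 _ h) = expChar h5 _ h * expChar h5 _ h
      rw [← expChar_add, ← expChar_add, ← expChar_add, he]
    rw [hyY]
    fin_cases i <;> fin_cases a <;> fin_cases b <;> simp only [rankThreeImage, Matrix.cons_val,
      Fin.reduceFinMk, Fin.zero_eta, Fin.mk_one, map_zero, smul_zero, torusHom_Y]
    · rw [e (s' := 1) (t' := 1) (by decide), Units.val_mul]
    · rw [e (s' := 0) (t' := 1) (by decide), Units.val_mul]
    · rw [e (s' := 1) (t' := 1) (by decide), Units.val_mul]
    · rw [e (s' := 1) (t' := 0) (by decide), Units.val_mul]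
    · rw [e (s' := 1) (t' := 1) (by decide), Units.val_mul]
  obtain ⟨ρ, hρg, hρx⟩ := exists_hopfAction (D := rankThreeDatum hζ) α β y hy
    (fun i a b => by
      -- The square of each derivation already kills the generators, so two factors are split off.
      rw [rankThreeDatum_m hζ, pow_add _ 3 2, sq]
      fin_cases i <;> fin_cases a <;> fin_cases b <;>
        simp [hyY, rankThreeImage])
    (fun i j hij a b => by
      rw [rankThreeDatum_χ_g]
      fin_cases i <;> fin_cases j <;>
        first
        | exact absurd rfl hij
        | fin_cases a <;> fin_cases b <;> simp [hyY, rankThreeImage, chiExp]) hwt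
  refine ⟨ρ, ?_, ?_, ?_⟩
  · intro i
    obtain ⟨φ, hφ, h⟩ := exists_mem_torusTranspose_eq_torusHom (q := q)
      (fun s => α s ((rankThreeDatum hζ).g i))
      (fun s => β s ((rankThreeDatum hζ).g i))
    exact ⟨φ, hφ, fun a => by rw [hρg, ← h]; rfl⟩
  · intro i a ha
    have : degreeOne q 2 ≤ (degreeOne q 2).comap (ρ.act ((rankThreeDatum hζ).x i)) := by
      refine Submodule.span_le.mpr ?_
      rintro _ ⟨⟨s, t⟩, rfl⟩
      have hY : ∀ s t, Y q 2 s t ∈ degreeOne q 2 := fun s t =>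
        Submodule.subset_span ⟨(s, t), rfl⟩
      simp only [SetLike.mem_coe, Submodule.mem_comap, hρx, hyY]
      fin_cases i <;> fin_cases s <;> fin_cases t <;> simp [rankThreeImage, hY]
    exact this ha
  · intro i h0
    -- All three derivations are nonzero on `A`, which they send to `D`, `B` and `C`.
    have hne : ∀ u, gen q u ≠ 0 := (linearIndependent_gen q).ne_zero
    have h := hyY i 0 0
    rw [← hρx, h0, LinearMap.zero_apply] at h
    fin_cases i
    exacts [hne 3 h.symm, hne 1 h.symm, hne 2 h.symm]

end rankThree

end QuantumMatrix

theorem mainTheorem3 (k : Type*) [Field k] [IsAlgClosed k] [CharZero k] :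
    (∀ (q : k), q ≠ 0 → q ≠ 1 → q ≠ -1 →
      ∀ (G : Type*) [CommGroup G] [Finite G] (θ : ℕ) (D : QuantumLinearDatum k G θ)
        (ρ : HopfAction k D.Bosonization (QuantumMatrix q 2)),
        (∀ i, D.m i ≠ 2) → QuantumMatrix.IsAdmissible q 2 D ρ → θ ≤ 3) ∧
    (∀ (q : k), IsPrimitiveRoot q 5 →
      ∃ (D : QuantumLinearDatum k (Multiplicative (Fin 3 → ZMod 5)) 3)
        (ρ : HopfAction k D.Bosonization (QuantumMatrix q 2)),
        (∀ i, D.m i ≠ 2) ∧ QuantumMatrix.IsAdmissible q 2 D ρ) := by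
  constructor
  · intro q hq hq1 hq2 G _ _ θ D ρ hm hρ
    exact hρ.rank_le hq (by rw [Ne, sq_eq_one_iff]; tauto) hm
  · intro q hq
    obtain ⟨ζ, rfl⟩ := hq.isUnit (by norm_num)
    have hζ : orderOf ζ = 5 := by rw [← orderOf_units, ← hq.eq_orderOf]
    obtain ⟨ρ, hρ⟩ := QuantumMatrix.exists_isAdmissible_rankThree ζ hζ
    exact ⟨QuantumMatrix.rankThreeDatum hζ, ρ,
      fun i => by rw [QuantumMatrix.rankThreeDatum_m]; norm_num, hρ⟩
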